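/- Let $G$ be a compact, connected and simply connected Lie group whose Lie algebra $\mathcal G$ is simple, and let $\langle\cdot,\cdot\rangle$ be a positive multiple of the Killing form of $\mathcal G$. Fix a maximal torus $G_0<G$ with Lie algebra $\mathcal G_0$, let $\mathcal G=\mathcal G_0\oplus\mathcal G_\perp$ be the orthogonal decomposition, $X=X_0+X_\perp$. An element of $\mathcal G$ is regular if its centralizer in $\mathcal G$ is the Lie algebra of a maximal torus; $\mathcal G^{\rm reg}$ is the set of regular elements and $\mathcal G_0^{\rm reg}=\mathcal G_0\cap\mathcal G^{\rm reg}$. For $\lambda\in\mathcal G_0^{\rm reg}$ put $r(\lambda)X=(\mathrm{ad}_\lambda|_{\mathcal G_\perp})^{-1}(X_\perp)$. For functions of $(g,J)\in G\times\mathcal G$ or of $(g,\lambda)\in G\times\mathcal G_0^{\rm reg}$ define $\nabla_1,\nabla_1'\in\mathcal G$ by $\langle X,\nabla_1F\rangle=\frac{d}{dt}|_{0}F(e^{tX}g,\cdot)$, $\langle X,\nabla_1'F\rangle=\frac{d}{dt}|_{0}F(ge^{tX},\cdot)$ for $X\in\mathcal G$, and let $d_2$ be the gradient with respect to the second variable ($\mathcal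 G$-valued on $G\times\mathcal G$, and $\mathcal G_0$-valued on $G\times\mathcal G_0^{\rm reg}$); write $\nabla h$ for the gradient $\nabla_1$ of a function $h$ on $G$. The canonical Poisson bracket on $T^*G\simeq G\times\mathcal G$ is $$\{\mathcal F,\mathcal H\}(g,J)=\langle\nabla_1\mathcal F,d_2\mathcal H\rangle-\langle\nabla_1\mathcal H,d_2\mathcal F\rangle+\langle J,[d_2\mathcal F,d_2\mathcal H]\rangle .$$ Let $G$ act on $G\times\mathcal G$ by $(g,J)\mapsto(\eta g\eta^{-1},\mathrm{Ad}_\eta J)$. If $F,H$ are the restrictions to $G\times\mathcal G_0^{\rm reg}$ of smooth $G$-invariant functions $\mathcal F,\mathcal H$ on $G\times\mathcal G^{\rm reg}$, their reduced bracket is $\{F,H\}'_{\rm red}(g,\lambda):=\{\mathcal F,\mathcal H\}(g,\lambda)$, and it is described by the expression $$\langle\nabla_1F,d_2H\rangle-\langle\nabla_1H,d_2F\rangle+\langle\nabla_1'F,r(\lambda)\nabla_1'H\rangle-\langle\nabla_1F,r(\lambda)\nabla_1H\rangle\qquad(1)$$ evaluated at $(g,\lambda)$. **Proposition.** Let $h\in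 C^\infty(G)$ be invariant under conjugation, and let $H$ be the restriction of $\mathcal H(g,J)=h(g)$ to $G\times\mathcal G_0^{\rm reg}$. For $F\in C^\infty(G\times\mathcal G_0^{\rm reg})$ put $$D_hF(g,\lambda):=-\langle d_2F(g,\lambda),\nabla h(g)\rangle+\langle\nabla_1'F(g,\lambda)-\nabla_1F(g,\lambda),r(\lambda)\nabla h(g)\rangle .$$ 1. For every $F\in C^\infty(G\times\mathcal G_0^{\rm reg})$, the expression (1) equals $D_hF(g,\lambda)$ at every $(g,\lambda)\in G\times\mathcal G_0^{\rm reg}$. 2. If $F$ is the restriction of a smooth $G$-invariant function on $G\times\mathcal G^{\rm reg}$, then $\{F,H\}'_{\rm red}=D_hF$ on $G\times\mathcal G_0^{\rm reg}$. 3. The corresponding reduced evolution equation on $G\times\mathcal G_0^{\rm reg}$ can be taken to be $$\dot g=[g,r(\lambda)\nabla h(g)],\qquad\dot\lambda=-(\nabla h(g))_0,$$ where $[g,X]=gX-Xg\in T_gG$ is the difference of the left and right translates of $X\in\mathcal G$. That is, for every $F\in C^\infty(G\times\mathcal G_0^{\rm reg})$, the derivative of $F$ along the vector field defined by the right-hand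 sides is $D_hF$, and $\frac{d}{dt}F(g(t),\lambda(t))=D_hF(g(t),\lambda(t))$ along every solution in $G\times\mathcal G_0^{\rm reg}$. -/

import Mathlib

open scoped Manifold ContDiff

noncomputable section

namespace CotangentReduction

instance instLEInftyMinSmoothness : ENat.LEInfty (minSmoothness ℝ 3) :=
  ⟨by rw [minSmoothness_of_isRCLikeNormedField]; exact ENat.LEInfty.out⟩

/-- The Lie algebra `𝒢` of the Lie group `G`: the tangent space at the identity, with the bracket
of left-invariant vector fields. -/
abbrev LieAlg (E : Type*) [NormedAddCommGroup E] [NormedSpace ℝ E]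
    (G : Type*) [TopologicalSpace G] [ChartedSpace E G] [Group G] : Type _ :=
  GroupLieAlgebra 𝓘(ℝ, E) G

section Norm

variable {E : Type*} [NormedAddCommGroup E] [NormedSpace ℝ E]
  {G : Type*} [TopologicalSpace G] [ChartedSpace E G] [Group G]

/-- The norm of the model space `E`, on the Lie algebra. It is used only to speak of derivatives
and of smoothness on `𝒢` (all norms on `𝒢` are equivalent). -/
instance instNormedAddCommGroupLieAlg : NormedAddCommGroup (LieAlg E G) :=
  let i : NormedAddCommGroup E := inferInstance
  { instAddCommGroupTangentSpace 𝓘(ℝ, E) (1 : G) with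
    toNorm := i.toNorm
    toMetricSpace := i.toMetricSpace.replaceTopology
      (U := instTopologicalSpaceTangentSpace 𝓘(ℝ, E) (1 : G)) rfl
    dist_eq := i.dist_eq }

instance instNormedSpaceLieAlg : NormedSpace ℝ (LieAlg E G) where
  norm_smul_le := (inferInstance : NormedSpace ℝ E).norm_smul_le

end Norm

/-- The vector `Y` that represents the linear functional `ℓ` with respect to `B`, that is,
`B X Y = ℓ X` for all `X` (unique when `B` is definite). -/
def representer {V : Type*} [AddCommGroup V] [Module ℝ V] (B : LinearMap.BilinForm ℝ V)
    (ℓ : V → ℝ) : V :=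
  Classical.epsilon fun Y => ∀ X, B X Y = ℓ X

section Torus

variable {E : Type*} [NormedAddCommGroup E] [NormedSpace ℝ E]
  {G : Type*} [TopologicalSpace G] [ChartedSpace E G] [Group G]

/-- `γ` is the one-parameter subgroup `t ↦ exp (t X)`: the integral curve through `1` of the
left-invariant vector field of `X`. -/
def IsOneParameterSubgroup (X : LieAlg E G) (γ : ℝ → G) : Prop :=
  γ 0 = 1 ∧ IsMIntegralCurve (I := 𝓘(ℝ, E)) γ (mulInvariantVectorField X)

/-- The Lie algebra `{X | exp (t X) ∈ T for all t}` of a closed subgroup `T` of `G`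
(this set is a linear subspace, hence equal to its span). -/
def subgroupLie (T : Subgroup G) : Submodule ℝ (LieAlg E G) :=
  Submodule.span ℝ {X | ∃ γ : ℝ → G, IsOneParameterSubgroup X γ ∧ ∀ t, γ t ∈ T}

/-- A torus in a compact Lie group: a closed connected abelian subgroup. -/
def IsTorus (T : Subgroup G) : Prop :=
  IsClosed (T : Set G) ∧ IsConnected (T : Set G) ∧ ∀ x ∈ T, ∀ y ∈ T, x * y = y * x

/-- A torus that is contained in no larger torus. -/
def IsMaximalTorus (T : Subgroup G) : Prop :=
  Maximal IsTorus T

/-- `J ∈ 𝒢` is regular: its centralizer in `𝒢` is the Lie algebra of a maximal torus. -/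
def IsRegularElement (J : LieAlg E G) : Prop :=
  ∃ T : Subgroup G, IsMaximalTorus T ∧ ∀ X : LieAlg E G, X ∈ subgroupLie T ↔ ⁅J, X⁆ = 0

/-- The adjoint action `J ↦ η J η⁻¹` of `G` on `𝒢`: the derivative at `1` of conjugation by `η`. -/
def adjointAction (η : G) (J : LieAlg E G) : LieAlg E G :=
  show E from mfderiv 𝓘(ℝ, E) 𝓘(ℝ, E) (fun x : G => η * x * η⁻¹) 1 J

end Torus

section Reduction

variable {E : Type*} [NormedAddCommGroup E] [NormedSpace ℝ E] [CompleteSpace E]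
  {G : Type*} [TopologicalSpace G] [ChartedSpace E G] [Group G] [LieGroup 𝓘(ℝ, E) ∞ G]

/-- The invariant inner product `⟨X, Y⟩`: the multiple by `c` of the Killing form. -/
def invForm (c : ℝ) : LinearMap.BilinForm ℝ (LieAlg E G) :=
  c • killingForm ℝ (LieAlg E G)

/-- The gradient `∇ f (g) ∈ 𝒢`, with `⟨X, ∇ f (g)⟩ = d/dt f (exp (t X) g)` at `t = 0`. -/
def nabla (c : ℝ) (f : G → ℝ) (g : G) : LieAlg E G :=
  representer (invForm c) fun X => mfderiv 𝓘(ℝ, E) 𝓘(ℝ, ℝ) (fun x : G => f (x * g)) 1 X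

/-- The gradient `∇' f (g) ∈ 𝒢`, with `⟨X, ∇' f (g)⟩ = d/dt f (g exp (t X))` at `t = 0`. -/
def nabla' (c : ℝ) (f : G → ℝ) (g : G) : LieAlg E G :=
  representer (invForm c) fun X => mfderiv 𝓘(ℝ, E) 𝓘(ℝ, ℝ) (fun x : G => f (g * x)) 1 X

/-- The gradient `d φ (J) ∈ 𝒢` of a function on `𝒢`. -/
def lieGrad (c : ℝ) (φ : LieAlg E G → ℝ) (J : LieAlg E G) : LieAlg E G :=
  representer (invForm c) fun X => fderiv ℝ φ J X

/-- The canonical Poisson bracket of the cotangent bundle `T^*G = G × 𝒢` (right trivialization):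
`⟨∇₁ 𝓕, d₂ 𝓗⟩ - ⟨∇₁ 𝓗, d₂ 𝓕⟩ + ⟨J, [d₂ 𝓕, d₂ 𝓗]⟩` at `(g, J)`. -/
def poissonBracket (c : ℝ) (𝓕 𝓗 : G × LieAlg E G → ℝ) (g : G) (J : LieAlg E G) : ℝ :=
  invForm c (nabla c (fun x => 𝓕 (x, J)) g) (lieGrad c (fun K => 𝓗 (g, K)) J)
    - invForm c (nabla c (fun x => 𝓗 (x, J)) g) (lieGrad c (fun K => 𝓕 (g, K)) J)
    + invForm c J ⁅lieGrad c (fun K => 𝓕 (g, K)) J, lieGrad c (fun K => 𝓗 (g, K)) J⁆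

/-- `𝓕` is a smooth function on the open subset `{(g, J) | J regular}` of `G × 𝒢`, invariant under
the action `(g, J) ↦ (η g η⁻¹, η J η⁻¹)` of `G`. -/
def IsSmoothInvariant (𝓕 : G × LieAlg E G → ℝ) : Prop :=
  (∀ (g : G) (J : LieAlg E G), IsRegularElement J →
      ContMDiffAt (𝓘(ℝ, E).prod 𝓘(ℝ, LieAlg E G)) 𝓘(ℝ, ℝ) ∞ 𝓕 (g, J)) ∧
    ∀ (η g : G) (J : LieAlg E G), IsRegularElement J →
      𝓕 (η * g * η⁻¹, adjointAction η J) = 𝓕 (g, J)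

variable (𝔱 : Submodule ℝ (LieAlg E G))

/-- `F` is a smooth function on the open subset `{(g, l) | l regular}` of `G × 𝔱`. -/
def IsSmoothOnRegular (F : G × 𝔱 → ℝ) : Prop :=
  ∀ (g : G) (l : 𝔱), IsRegularElement (l : LieAlg E G) →
    ContMDiffAt (𝓘(ℝ, E).prod 𝓘(ℝ, 𝔱)) 𝓘(ℝ, ℝ) ∞ F (g, l)

/-- The restriction to `G × 𝔱` of a function on `G × 𝒢`. -/
def restrict (𝓕 : G × LieAlg E G → ℝ) : G × 𝔱 → ℝ :=
  fun p => 𝓕 (p.1, (p.2 : LieAlg E G))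

/-- The orthogonal complement of `𝔱` in `𝒢`. -/
def perp (c : ℝ) : Submodule ℝ (LieAlg E G) :=
  (invForm c).orthogonal 𝔱

/-- The component `X₀ ∈ 𝔱` of `X` in the orthogonal decomposition `𝒢 = 𝔱 + 𝔱^⊥`. -/
def zeroPart (c : ℝ) (X : LieAlg E G) : 𝔱 :=
  Classical.epsilon fun Y : 𝔱 => X - (Y : LieAlg E G) ∈ perp 𝔱 c

/-- The dynamical `r`-matrix `r(l) X = (ad_l restricted to 𝔱^⊥)⁻¹ (X_⊥)`, where `X_⊥ = X - X₀`. -/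
def rMatrix (c : ℝ) (l : 𝔱) (X : LieAlg E G) : LieAlg E G :=
  Function.invFunOn (fun Y : LieAlg E G => ⁅(l : LieAlg E G), Y⁆) (perp 𝔱 c : Set (LieAlg E G))
    (X - (zeroPart 𝔱 c X : LieAlg E G))

/-- The derivative `d₂ F ∈ 𝔱`, with `⟨X₀, d₂ F (g, l)⟩ = d/dt F (g, l + t X₀)` at `t = 0`, for
all `X₀ ∈ 𝔱`. -/
def torusGrad (c : ℝ) (F : G × 𝔱 → ℝ) (g : G) (l : 𝔱) : 𝔱 :=
  representer ((invForm c).restrict 𝔱) fun X => fderiv ℝ (fun m : 𝔱 => F (g, m)) l X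

/-- The reduced bracket formula
`⟨∇₁F, d₂H⟩ - ⟨∇₁H, d₂F⟩ + ⟨∇₁'F, r(l) ∇₁'H⟩ - ⟨∇₁F, r(l) ∇₁H⟩` at `(g, l)`. -/
def reducedBracket (c : ℝ) (F H : G × 𝔱 → ℝ) (g : G) (l : 𝔱) : ℝ :=
  invForm c (nabla c (fun x => F (x, l)) g) (torusGrad 𝔱 c H g l : LieAlg E G)
    - invForm c (nabla c (fun x => H (x, l)) g) (torusGrad 𝔱 c F g l : LieAlg E G)
    + invForm c (nabla' c (fun x => F (x, l)) g) (rMatrix 𝔱 c l (nabla' c (fun x => H (x, l)) g))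
    - invForm c (nabla c (fun x => F (x, l)) g) (rMatrix 𝔱 c l (nabla c (fun x => H (x, l)) g))

/-- The simplified formula `-⟨d₂F, ∇h(g)⟩ + ⟨∇₁'F - ∇₁F, r(l) ∇h(g)⟩` at `(g, l)`. -/
def simplifiedBracket (c : ℝ) (F : G × 𝔱 → ℝ) (h : G → ℝ) (g : G) (l : 𝔱) : ℝ :=
  -invForm c (torusGrad 𝔱 c F g l : LieAlg E G) (nabla c h g)
    + invForm c (nabla' c (fun x => F (x, l)) g - nabla c (fun x => F (x, l)) g)
        (rMatrix 𝔱 c l (nabla c h g))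

/-- The vector `[g, X] = g X - X g ∈ T_g G`: the difference of the images of `X ∈ 𝒢` under the
derivatives of the left and of the right translation by `g`. -/
def groupCommutator (g : G) (X : LieAlg E G) : TangentSpace 𝓘(ℝ, E) g :=
  show E from
    (show E from mfderiv 𝓘(ℝ, E) 𝓘(ℝ, E) (fun x : G => g * x) 1 X)
      - (show E from mfderiv 𝓘(ℝ, E) 𝓘(ℝ, E) (fun x : G => x * g) 1 X)

/-- The vector field `(g, l) ↦ ([g, r(l) ∇h(g)], -(∇h(g))₀)` on `G × 𝔱`. -/
def evolutionField (c : ℝ) (h : G → ℝ) (p : G × 𝔱) :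
    TangentSpace (𝓘(ℝ, E).prod 𝓘(ℝ, 𝔱)) p :=
  show E × 𝔱 from
    (groupCommutator p.1 (rMatrix 𝔱 c p.2 (nabla c h p.1)), -zeroPart 𝔱 c (nabla c h p.1))

end Reduction

end CotangentReduction

end

open CotangentReduction

namespace CotangentReduction

open scoped Topology

/-! ### The adjoint action: smoothness and multiplicativity. -/

section Adjoint

variable {E : Type*} [NormedAddCommGroup E] [NormedSpace ℝ E]
  {G : Type*} [TopologicalSpace G] [ChartedSpace E G] [Group G] [LieGroup 𝓘(ℝ, E) ∞ G]

/-! Compactness makes `invForm` definite. Averaging over Haar measure gives an invariant inner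
product for which every `ad X` is skew, so `tr (ad X)² = 0` forces `ad X = 0`, hence `X = 0` because
a simple Lie algebra has trivial centre (`invForm_definite`). Only definiteness is used, never the
sign. It follows that the gradients (of differentiable functions or not) and the projection to `𝔱`,
which are defined by choice, satisfy their defining equations.

The second ingredient is that a regular `l ∈ 𝔱` has centralizer exactly `𝔱`
(`lie_eq_zero_iff_mem_subgroupLie`); regularity by itself only provides some maximal torus with this
property. If `X` commutes with `l`, so do all `Ad_g X` with `g ∈ G₀`. They commute with one another,
and their `ad` are roots of one separable polynomial. Commuting roots of such a polynomial are
isolated, so connectedness of `G₀` makes `Ad_g X` constant, and maximality of `G₀` puts `X` in `𝔱`.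
Hence `ad l` is invertible on `𝔱^⊥`, and `r(l)` really inverts it (`lie_rMatrix`).

The identities are then short. A class function has `∇'h = ∇h` and `d₂H = 0`, which collapses the
reduced bracket formula. Differentiating the invariance of `𝓕` gives `⟨X, ∇'𝓕 - ∇𝓕⟩ = ⟨[X, J],
d₂𝓕⟩`; for `X = r(l)∇h` and `J = l` the right side is `-⟨(∇h)_⊥, d₂𝓕⟩`, exactly the part of `-⟨∇h,
d₂𝓕⟩` that the torus gradient misses. The evolution statements are the chain rule. The invariance
arguments rest on the derivative of `Ad` at `1` being the bracket (`hasMFDerivAt_adjointAction`),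
which is computed in a chart. -/

lemma mdifferentiable_mul_left (g : G) :
    MDifferentiable 𝓘(ℝ, E) 𝓘(ℝ, E) (fun x : G => g * x) :=
  (contMDiff_mul_left (I := 𝓘(ℝ, E)) (n := ∞)).mdifferentiable (by simp)

lemma mdifferentiable_mul_right (g : G) :
    MDifferentiable 𝓘(ℝ, E) 𝓘(ℝ, E) (fun x : G => x * g) :=
  (contMDiff_mul_right (I := 𝓘(ℝ, E)) (n := ∞)).mdifferentiable (by simp)

lemma contMDiff_conj (g : G) :
    ContMDiff 𝓘(ℝ, E) 𝓘(ℝ, E) ∞ (fun x : G => g * x * g⁻¹) :=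
  (contMDiff_const.mul contMDiff_id).mul contMDiff_const

lemma mdifferentiable_conj (g : G) :
    MDifferentiable 𝓘(ℝ, E) 𝓘(ℝ, E) (fun x : G => g * x * g⁻¹) :=
  (contMDiff_conj g).mdifferentiable (by simp)

/-- The adjoint action, as a continuous linear map. -/
noncomputable def adjointCLM (η : G) : LieAlg E G →L[ℝ] LieAlg E G :=
  (mfderiv 𝓘(ℝ, E) 𝓘(ℝ, E) (fun x : G => η * x * η⁻¹) 1 : E →L[ℝ] E)

omit [LieGroup 𝓘(ℝ, E) ∞ G] in
lemma adjointCLM_apply (η : G) (X : LieAlg E G) : adjointCLM η X = adjointAction η X := rfl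

lemma hasMFDerivAt_conj (η : G) {p : G} (hp : p = 1) :
    HasMFDerivAt 𝓘(ℝ, E) 𝓘(ℝ, E) (fun x : G => η * x * η⁻¹) p
      (adjointCLM η : E →L[ℝ] E) := by
  subst hp
  exact (mdifferentiable_conj η 1).hasMFDerivAt

omit [LieGroup 𝓘(ℝ, E) ∞ G] in
lemma adjointCLM_one : adjointCLM (1 : G) = ContinuousLinearMap.id ℝ (LieAlg E G) := by
  have h : (fun x : G => (1 : G) * x * (1 : G)⁻¹) = id := by ext x; simp
  unfold adjointCLM
  rw [h]
  exact mfderiv_id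

lemma adjointCLM_mul (g k : G) :
    adjointCLM (E := E) (g * k) = (adjointCLM g).comp (adjointCLM k) := by
  have h : (fun x : G => (g * k) * x * (g * k)⁻¹)
      = (fun x : G => g * x * g⁻¹) ∘ (fun x : G => k * x * k⁻¹) := by
    ext x; simp [mul_assoc]
  have h1 := HasMFDerivAt.comp (1 : G) (hasMFDerivAt_conj (E := E) g (p := k * 1 * k⁻¹) (by simp))
    (hasMFDerivAt_conj (E := E) k (p := 1) rfl)
  rw [← h] at h1
  exact h1.mfderiv

/-- Conjugation is jointly smooth in `(η, x)`, so its `x`-derivative at `1` is smooth in `η` when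
read in tangent coordinates. -/
lemma contMDiff_adjointCLM :
    ContMDiff 𝓘(ℝ, E) 𝓘(ℝ, LieAlg E G →L[ℝ] LieAlg E G) ∞
      (fun η : G => adjointCLM (E := E) η) := by
  intro η
  have h := ContMDiffAt.mfderiv (n := ∞) (m := ∞) (I := 𝓘(ℝ, E)) (I' := 𝓘(ℝ, E)) (x₀ := η)
    (J := 𝓘(ℝ, E)) (fun η x : G => η * x * η⁻¹) (fun _ => (1 : G))
    (by
      apply ContMDiff.contMDiffAt
      exact (contMDiff_fst.mul contMDiff_snd).mul contMDiff_fst.inv)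
    contMDiffAt_const (by simp)
  refine ContMDiffAt.congr_of_eventuallyEq h (Filter.Eventually.of_forall fun x => ?_)
  -- Source and target base points are both `1` because conjugation fixes `1`, so the coordinate
  -- changes are trivial.
  have key : ∀ (p q : G) (_ : p = 1) (_ : q = 1) (φ : E →L[ℝ] E),
      φ = (tangentBundleCore 𝓘(ℝ, E) G).coordChange (achart E p) (achart E q) p ∘L
        φ ∘L (tangentBundleCore 𝓘(ℝ, E) G).coordChange (achart E (1 : G)) (achart E (1 : G)) 1 := by
    rintro p q rfl rfl φ
    ext v
    simp only [ContinuousLinearMap.comp_apply]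
    rw [(tangentBundleCore 𝓘(ℝ, E) G).coordChange_self _ _ (mem_chart_source _ _),
      (tangentBundleCore 𝓘(ℝ, E) G).coordChange_self _ _ (mem_chart_source _ _)]
  have := inTangentCoordinates_eq (I := 𝓘(ℝ, E)) (I' := 𝓘(ℝ, E)) (fun _ : G => (1 : G))
    (fun y : G => y * 1 * y⁻¹) (fun y => adjointCLM (E := E) y) (x₀ := η) (x := x)
    (mem_chart_source _ _) (by simp)
  exact (key _ _ (by simp) (by simp) _).trans this.symm

lemma contMDiff_adjointAction (X : LieAlg E G) :
    ContMDiff 𝓘(ℝ, E) 𝓘(ℝ, LieAlg E G) ∞ (fun η : G => adjointAction η X) :=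
  contMDiff_adjointCLM.clm_apply contMDiff_const

lemma adjointAction_mul (g k : G) (X : LieAlg E G) :
    adjointAction (g * k) X = adjointAction g (adjointAction k X) := by
  simp [← adjointCLM_apply, adjointCLM_mul]

omit [LieGroup 𝓘(ℝ, E) ∞ G] in
lemma adjointAction_one (X : LieAlg E G) : adjointAction (1 : G) X = X := by
  simp [← adjointCLM_apply, adjointCLM_one]

lemma adjointAction_inv_self (g : G) (X : LieAlg E G) :
    adjointAction g⁻¹ (adjointAction g X) = X := by
  rw [← adjointAction_mul, inv_mul_cancel, adjointAction_one]

lemma adjointAction_self_inv (g : G) (X : LieAlg E G) :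
    adjointAction g (adjointAction g⁻¹ X) = X := by
  rw [← adjointAction_mul, mul_inv_cancel, adjointAction_one]

end Adjoint

/-! ### A chain rule between model spaces. -/

section Comp

variable {E H M E' H' M' E'' H'' M'' : Type*}
  [NormedAddCommGroup E] [NormedSpace ℝ E] [TopologicalSpace H] [TopologicalSpace M]
  [NormedAddCommGroup E'] [NormedSpace ℝ E'] [TopologicalSpace H'] [TopologicalSpace M']
  [NormedAddCommGroup E''] [NormedSpace ℝ E''] [TopologicalSpace H''] [TopologicalSpace M'']
  [ChartedSpace H M] [ChartedSpace H' M'] [ChartedSpace H'' M'']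
  {I : ModelWithCorners ℝ E H} {I' : ModelWithCorners ℝ E' H'} {I'' : ModelWithCorners ℝ E'' H''}

/-- Chain rule, with derivatives between the model spaces. -/
lemma hasMFDerivAt_comp_of_eq {f : M → M'} {g : M' → M''} {f' : E →L[ℝ] E'} {g' : E' →L[ℝ] E''}
    {x : M} {y : M'} (hg : HasMFDerivAt I' I'' g y g') (hf : HasMFDerivAt I I' f x f')
    (h : f x = y) : HasMFDerivAt I I'' (fun z => g (f z)) x (g'.comp f') := by
  subst h
  exact hg.comp x hf

end Comp

/-! ### The bracket and the derivative of `Ad`, from the multiplication in a chart. -/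

section ChartMul

variable {E : Type*} [NormedAddCommGroup E] [NormedSpace ℝ E]
  {G : Type*} [TopologicalSpace G] [ChartedSpace E G] [Group G] [LieGroup 𝓘(ℝ, E) ∞ G]

variable (E G) in
/-- The multiplication of the Lie group, in the chart at the identity. -/
noncomputable def chartMul (p : E × E) : E :=
  extChartAt 𝓘(ℝ, E) (1 : G)
    ((extChartAt 𝓘(ℝ, E) (1 : G)).symm p.1 * (extChartAt 𝓘(ℝ, E) (1 : G)).symm p.2)

variable (E G) in
/-- The coordinate of the identity. -/
noncomputable def chartOne : E := extChartAt 𝓘(ℝ, E) (1 : G) 1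

omit [LieGroup 𝓘(ℝ, E) ∞ G] in
lemma chart_symm_chartOne : (extChartAt 𝓘(ℝ, E) (1 : G)).symm (chartOne E G) = 1 :=
  extChartAt_to_inv _

lemma contMDiffAt_chart_symm :
    ContMDiffAt 𝓘(ℝ, E) 𝓘(ℝ, E) ∞ (extChartAt 𝓘(ℝ, E) (1 : G)).symm (chartOne E G) :=
  (contMDiffOn_extChartAt_symm (1 : G)).contMDiffAt (extChartAt_target_mem_nhds (1 : G))

lemma contDiffAt_chartMul : ContDiffAt ℝ ∞ (chartMul E G) (chartOne E G, chartOne E G) := by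
  have h1 : ContMDiffAt (𝓘(ℝ, E).prod 𝓘(ℝ, E)) 𝓘(ℝ, E) ∞
      (fun p : E × E => (extChartAt 𝓘(ℝ, E) (1 : G)).symm p.1 *
        (extChartAt 𝓘(ℝ, E) (1 : G)).symm p.2) (chartOne E G, chartOne E G) :=
    ((contMDiffAt_chart_symm (E := E) (G := G)).comp_of_eq contMDiffAt_fst rfl).mul
      ((contMDiffAt_chart_symm (E := E) (G := G)).comp_of_eq contMDiffAt_snd rfl)
  have h2 : ContMDiffAt (𝓘(ℝ, E).prod 𝓘(ℝ, E)) 𝓘(ℝ, E) ∞ (chartMul E G)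
      (chartOne E G, chartOne E G) :=
    ContMDiffAt.comp_of_eq (I' := 𝓘(ℝ, E)) (y := (1 : G))
      (contMDiffAt_extChartAt) h1 (by simp only [chart_symm_chartOne, mul_one])
  rw [← modelWithCornersSelf_prod, chartedSpaceSelf_prod] at h2
  exact h2.contDiffAt

omit [LieGroup 𝓘(ℝ, E) ∞ G] in
lemma hasFDerivAt_of_hasMFDerivAt_one {F : Type*} [NormedAddCommGroup F] [NormedSpace ℝ F]
    {f : G → F} {φ : E →L[ℝ] F} (hf : HasMFDerivAt 𝓘(ℝ, E) 𝓘(ℝ, F) f 1 φ) :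
    HasFDerivAt (fun y => f ((extChartAt 𝓘(ℝ, E) (1 : G)).symm y)) φ (chartOne E G) := by
  have h := hf.2
  rw [modelWithCornersSelf_coe, Set.range_id] at h
  exact hasFDerivWithinAt_univ.1 h

/-- A property that holds near the identity holds near its coordinate. -/
lemma eventually_chart (p : G → Prop) (hp : ∀ᶠ g in 𝓝 1, p g) :
    ∀ᶠ x in 𝓝 (chartOne E G), p ((extChartAt 𝓘(ℝ, E) (1 : G)).symm x) := by
  have := (contMDiffAt_chart_symm (E := E) (G := G)).continuousAt
  rw [ContinuousAt, chart_symm_chartOne] at this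
  exact this.eventually hp

lemma eventually_mdifferentiableAt_chart :
    ∀ᶠ g : G in 𝓝 1, MDifferentiableAt 𝓘(ℝ, E) 𝓘(ℝ, E) (extChartAt 𝓘(ℝ, E) (1 : G)) g := by
  filter_upwards [(chartAt E (1 : G)).open_source.mem_nhds (mem_chart_source E (1 : G))] with g hg
  exact mdifferentiableAt_extChartAt hg

lemma eventually_differentiableAt_chartMul :
    ∀ᶠ p in 𝓝 (chartOne E G, chartOne E G), DifferentiableAt ℝ (chartMul E G) p := by
  have := (contDiffAt_chartMul (E := E) (G := G)).of_le (m := 1) (by simp)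
  exact (this.eventually (by simp)).mono fun p hp => hp.differentiableAt (by simp)

/-- Left translation by a point near `1` is a partial derivative of `chartMul`. Quantifying over all
`φ` allows derivatives obtained from any chain rule to be inserted. -/
lemma fderiv_chartMul_right :
    ∀ᶠ x in 𝓝 (chartOne E G), ∀ φ : E →L[ℝ] E,
      HasMFDerivAt 𝓘(ℝ, E) 𝓘(ℝ, E) (fun y : G => extChartAt 𝓘(ℝ, E) (1 : G) ((extChartAt 𝓘(ℝ, E) (1 : G)).symm x * y)) 1 φ →
      ∀ Y, φ Y = fderiv ℝ (chartMul E G) (x, chartOne E G) (0, Y) := by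
  have hc : ContinuousAt (fun x : E => (x, chartOne E G)) (chartOne E G) := by fun_prop
  filter_upwards [hc.eventually eventually_differentiableAt_chartMul] with x hx φ hφ Y
  have h2 : HasFDerivAt (fun y : E => (x, y)) (ContinuousLinearMap.inr ℝ E E)
      (chartOne E G) := hasFDerivAt_prodMk_right x _
  have h3 := HasFDerivAt.comp (f := fun y : E => (x, y)) (chartOne E G) hx.hasFDerivAt h2
  rw [(hasFDerivAt_of_hasMFDerivAt_one hφ).unique h3]
  rfl

lemma fderiv_chartMul_left :
    ∀ᶠ x in 𝓝 (chartOne E G), ∀ φ : E →L[ℝ] E,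
      HasMFDerivAt 𝓘(ℝ, E) 𝓘(ℝ, E) (fun y : G => extChartAt 𝓘(ℝ, E) (1 : G) (y * (extChartAt 𝓘(ℝ, E) (1 : G)).symm x)) 1 φ →
      ∀ Y, φ Y = fderiv ℝ (chartMul E G) (chartOne E G, x) (Y, 0) := by
  have hc : ContinuousAt (fun x : E => (chartOne E G, x)) (chartOne E G) := by fun_prop
  filter_upwards [hc.eventually eventually_differentiableAt_chartMul] with x hx φ hφ Y
  have h2 : HasFDerivAt (fun y : E => (y, x)) (ContinuousLinearMap.inl ℝ E E)
      (chartOne E G) := hasFDerivAt_prodMk_left _ x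
  have h3 := HasFDerivAt.comp (f := fun y : E => (y, x)) (chartOne E G) hx.hasFDerivAt h2
  rw [(hasFDerivAt_of_hasMFDerivAt_one hφ).unique h3]
  rfl

omit [LieGroup 𝓘(ℝ, E) ∞ G] in
lemma chartMul_one_left : ∀ᶠ x in 𝓝 (chartOne E G), chartMul E G (chartOne E G, x) = x := by
  filter_upwards [extChartAt_target_mem_nhds (I := 𝓘(ℝ, E)) (1 : G)] with x hx
  rw [chartMul, chart_symm_chartOne, one_mul, (extChartAt 𝓘(ℝ, E) (1 : G)).right_inv hx]

omit [LieGroup 𝓘(ℝ, E) ∞ G] in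
lemma chartMul_one_right : ∀ᶠ x in 𝓝 (chartOne E G), chartMul E G (x, chartOne E G) = x := by
  filter_upwards [extChartAt_target_mem_nhds (I := 𝓘(ℝ, E)) (1 : G)] with x hx
  rw [chartMul, chart_symm_chartOne, mul_one, (extChartAt 𝓘(ℝ, E) (1 : G)).right_inv hx]

lemma fderiv_chartMul_one_left (X : E) :
    fderiv ℝ (chartMul E G) (chartOne E G, chartOne E G) (X, 0) = X := by
  have hd : DifferentiableAt ℝ (chartMul E G) (chartOne E G, chartOne E G) :=
    contDiffAt_chartMul.differentiableAt (by simp)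
  have h1 := HasFDerivAt.comp (f := fun y : E => (y, chartOne E G)) (chartOne E G) hd.hasFDerivAt
    (hasFDerivAt_prodMk_left (𝕜 := ℝ) (chartOne E G) (chartOne E G))
  have e1 := (h1.congr_of_eventuallyEq
    (f₁ := id) (chartMul_one_right.mono fun x hx => hx.symm)).unique (hasFDerivAt_id _)
  exact congrArg (fun φ : E →L[ℝ] E => φ X) e1

lemma fderiv_chartMul_one_right (X : E) :
    fderiv ℝ (chartMul E G) (chartOne E G, chartOne E G) (0, X) = X := by
  have hd : DifferentiableAt ℝ (chartMul E G) (chartOne E G, chartOne E G) :=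
    contDiffAt_chartMul.differentiableAt (by simp)
  have h1 := HasFDerivAt.comp (f := fun y : E => (chartOne E G, y)) (chartOne E G) hd.hasFDerivAt
    (hasFDerivAt_prodMk_right (𝕜 := ℝ) (chartOne E G) (chartOne E G))
  have e1 := (h1.congr_of_eventuallyEq
    (f₁ := id) (chartMul_one_left.mono fun x hx => hx.symm)).unique (hasFDerivAt_id _)
  exact congrArg (fun φ : E →L[ℝ] E => φ X) e1

/-- The left-invariant vector field of `X`, in the chart at the identity. -/
lemma mpullback_mulInvariantVectorField_chart (X : LieAlg E G) :
    (VectorField.mpullbackWithin 𝓘(ℝ, E) 𝓘(ℝ, E) (extChartAt 𝓘(ℝ, E) (1 : G)).symm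
      (mulInvariantVectorField X) (Set.range 𝓘(ℝ, E)) : E → E)
      =ᶠ[𝓝 (chartOne E G)] fun x => fderiv ℝ (chartMul E G) (x, chartOne E G) (0, (X : E)) := by
  filter_upwards [fderiv_chartMul_right (E := E) (G := G),
    eventually_chart _ (eventually_mdifferentiableAt_chart (E := E) (G := G)),
    extChartAt_target_mem_nhds (I := 𝓘(ℝ, E)) (1 : G)] with x hx hd ht
  have h1 := hasMFDerivAt_comp_of_eq (x := (1 : G)) hd.hasMFDerivAt
    (mdifferentiable_mul_left (E := E) ((extChartAt 𝓘(ℝ, E) (1 : G)).symm x) 1).hasMFDerivAt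
    (by simp only [mul_one])
  rw [VectorField.mpullbackWithin_apply]
  have h2 := ContinuousLinearMap.inverse_eq
    (mfderivWithin_extChartAt_symm_comp_mfderiv_extChartAt (I := 𝓘(ℝ, E)) ht)
    (mfderiv_extChartAt_comp_mfderivWithin_extChartAt_symm (I := 𝓘(ℝ, E)) ht)
  rw [h2]
  exact hx _ h1 X

lemma hasFDerivAt_fderiv_chartMul_right (X : E) :
    HasFDerivAt (fun x => fderiv ℝ (chartMul E G) (x, chartOne E G) (0, X))
      (((fderiv ℝ (fderiv ℝ (chartMul E G)) (chartOne E G, chartOne E G)).comp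
        (ContinuousLinearMap.inl ℝ E E)).flip (0, X)) (chartOne E G) := by
  have hd : DifferentiableAt ℝ (fderiv ℝ (chartMul E G)) (chartOne E G, chartOne E G) :=
    ((contDiffAt_chartMul (E := E) (G := G)).fderiv_right (m := 1)
      (by norm_cast)).differentiableAt (by simp)
  have h1 := HasFDerivAt.comp (f := fun y : E => (y, chartOne E G)) (chartOne E G) hd.hasFDerivAt
    (hasFDerivAt_prodMk_left (𝕜 := ℝ) (chartOne E G) (chartOne E G))
  have h2 := h1.clm_apply (hasFDerivAt_const ((0, X) : E × E) _)
  convert! h2 using 1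
  ext Y
  simp

/-- Product rule: the first partial derivative of `chartMul` at the identity is the identity map, so
the moving vector `u` contributes `u'` itself. -/
lemma hasFDerivAt_fderiv_chartMul_left {u : E → E} {u' : E →L[ℝ] E}
    (hu : HasFDerivAt u u' (chartOne E G)) :
    HasFDerivAt (fun x => fderiv ℝ (chartMul E G) (chartOne E G, x) (u x, 0))
      (u' + ((fderiv ℝ (fderiv ℝ (chartMul E G)) (chartOne E G, chartOne E G)).comp
        (ContinuousLinearMap.inr ℝ E E)).flip (u (chartOne E G), 0)) (chartOne E G) := by
  have hd : DifferentiableAt ℝ (fderiv ℝ (chartMul E G)) (chartOne E G, chartOne E G) :=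
    ((contDiffAt_chartMul (E := E) (G := G)).fderiv_right (m := 1)
      (by norm_cast)).differentiableAt (by simp)
  have h1 := HasFDerivAt.comp (f := fun y : E => (chartOne E G, y)) (chartOne E G) hd.hasFDerivAt
    (hasFDerivAt_prodMk_right (𝕜 := ℝ) (chartOne E G) (chartOne E G))
  have h2 := h1.clm_apply (hu.prodMk (hasFDerivAt_const (0 : E) _))
  convert! h2 using 1
  ext Y
  simp [fderiv_chartMul_one_left]

/-- The Lie bracket is the antisymmetrized second derivative of the multiplication. -/
lemma lie_eq_chartMul [CompleteSpace E] (X Y : LieAlg E G) :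
    (⁅X, Y⁆ : LieAlg E G) =
      (fderiv ℝ (fderiv ℝ (chartMul E G)) (chartOne E G, chartOne E G) ((X : E), 0) (0, (Y : E))
        - fderiv ℝ (fderiv ℝ (chartMul E G)) (chartOne E G, chartOne E G) ((Y : E), 0) (0, (X : E))
        : E) := by
  have hV := mpullback_mulInvariantVectorField_chart (G := G) X
  have hW := mpullback_mulInvariantVectorField_chart (G := G) Y
  -- The bracket on a manifold is a bracket of chart pullbacks, transported back by the derivative
  -- of the chart. At the base point that derivative is the identity, and only the germs of the
  -- fields matter.
  have key : ∀ (A : E →L[ℝ] E) (S : Set E) (V W v w : E → E), A = ContinuousLinearMap.id ℝ E →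
      S = Set.univ → V =ᶠ[𝓝 (chartOne E G)] v → W =ᶠ[𝓝 (chartOne E G)] w →
      A.inverse (VectorField.lieBracketWithin ℝ V W S (chartOne E G))
        = fderiv ℝ w (chartOne E G) (v (chartOne E G))
          - fderiv ℝ v (chartOne E G) (w (chartOne E G)) := by
    rintro A S V W v w rfl rfl h1 h2
    rw [VectorField.lieBracketWithin_univ, h1.lieBracket_vectorField_eq h2, VectorField.lieBracket]
    simp
  refine (key _ _ _ _ _ _ mfderiv_extChartAt_self (by simp) hV hW).trans ?_
  have hX := fderiv_chartMul_one_right (E := E) (G := G) X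
  have hY := fderiv_chartMul_one_right (E := E) (G := G) Y
  have hX' := (hasFDerivAt_fderiv_chartMul_right (E := E) (G := G) X).fderiv
  have hY' := (hasFDerivAt_fderiv_chartMul_right (E := E) (G := G) Y).fderiv
  exact congrArg₂ (fun a b : E => a - b) (congrArg₂ (fun (φ : E →L[ℝ] E) v => φ v) hY' hX)
    (congrArg₂ (fun (φ : E →L[ℝ] E) v => φ v) hX' hY)

/-- The derivative at `1` of the adjoint action is the Lie bracket. -/
lemma hasMFDerivAt_adjointAction [CompleteSpace E] (Y : LieAlg E G) :
    ∃ φ : E →L[ℝ] LieAlg E G, HasMFDerivAt 𝓘(ℝ, E) 𝓘(ℝ, LieAlg E G)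
      (fun η : G => adjointAction η Y) 1 φ ∧ ∀ X : LieAlg E G, φ X = ⁅X, Y⁆ := by
  have h := ((contMDiff_adjointAction (G := G) Y).mdifferentiable (by simp) 1).hasMFDerivAt
  refine ⟨_, h, fun X => ?_⟩
  obtain ⟨φ, hφ⟩ : ∃ φ : E →L[ℝ] E, φ = mfderiv 𝓘(ℝ, E) 𝓘(ℝ, LieAlg E G)
    (fun η : G => adjointAction η Y) 1 := ⟨_, rfl⟩
  obtain ⟨u, hu⟩ : ∃ u : E → E,
    u = fun x => adjointAction ((extChartAt 𝓘(ℝ, E) (1 : G)).symm x) Y := ⟨_, rfl⟩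
  obtain ⟨y, hy⟩ : ∃ y : E, y = Y := ⟨_, rfl⟩
  have h1 : HasFDerivAt u φ (chartOne E G) := by
    rw [hu, hφ]
    exact hasFDerivAt_of_hasMFDerivAt_one h
  have h0 : u (chartOne E G) = y := by
    rw [hu, hy]
    exact (congrArg (fun g => adjointAction g Y) chart_symm_chartOne).trans (adjointAction_one Y)
  have h2 := hasFDerivAt_fderiv_chartMul_left (G := G) h1
  -- Since `g y = (g y g⁻¹) g`, right-translating `Ad_g Y` by `g` gives the left translate of `Y`.
  have h3 : (fun x => fderiv ℝ (chartMul E G) (chartOne E G, x) (u x, 0)) =ᶠ[𝓝 (chartOne E G)]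
      fun x => fderiv ℝ (chartMul E G) (x, chartOne E G) (0, y) := by
    filter_upwards [fderiv_chartMul_right (E := E) (G := G), fderiv_chartMul_left (E := E) (G := G),
      eventually_chart _ (eventually_mdifferentiableAt_chart (E := E) (G := G))] with x hr hl hd
    have hux : u x = adjointAction ((extChartAt 𝓘(ℝ, E) (1 : G)).symm x) Y := by rw [hu]
    set g := (extChartAt 𝓘(ℝ, E) (1 : G)).symm x
    have k1 := hasMFDerivAt_comp_of_eq (x := (1 : G)) hd.hasMFDerivAt
      (mdifferentiable_mul_left (E := E) g 1).hasMFDerivAt (by simp only [mul_one])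
    have k2 := hasMFDerivAt_comp_of_eq (x := (1 : G)) hd.hasMFDerivAt
      (mdifferentiable_mul_right (E := E) g 1).hasMFDerivAt (by simp only [one_mul])
    have k3 := hasMFDerivAt_comp_of_eq k2 (hasMFDerivAt_conj (E := E) g (p := 1) rfl) (by simp)
    have k4 := k3.congr_of_eventuallyEq (f₁ := fun y => extChartAt 𝓘(ℝ, E) (1 : G) (g * y))
      (Filter.Eventually.of_forall fun y => by simp only [inv_mul_cancel_right])
    rw [← hr _ k1, ← hl _ k2, hux, hy]
    exact congrArg (fun φ : E →L[ℝ] E => φ Y) (hasMFDerivAt_unique k4 k1)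
  -- With `m` the multiplication in the chart, differentiating this identity gives `φ X + D²m (0, X)
  -- (Y, 0) = D²m (X, 0) (0, Y)`; symmetry of `D²m` then produces the bracket.
  have h4 := (h2.congr_of_eventuallyEq h3.symm).unique (hasFDerivAt_fderiv_chartMul_right (G := G) y)
  have h5 := congrArg (fun φ : E →L[ℝ] E => φ X) h4
  have hsymm : IsSymmSndFDerivAt ℝ (chartMul E G) (chartOne E G, chartOne E G) :=
    (contDiffAt_chartMul (E := E) (G := G)).isSymmSndFDerivAt
      (by rw [minSmoothness_of_isRCLikeNormedField]; exact ENat.LEInfty.out)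
  rw [h0] at h5
  rw [← hφ, lie_eq_chartMul, ← hy]
  refine eq_sub_of_add_eq (Eq.trans ?_ h5)
  rw [hsymm.eq]
  rfl

end ChartMul

/-! ### Skew operators for a definite form. -/

section LinearAlgebra

variable {V : Type*} [AddCommGroup V] [Module ℝ V]

/-- Definiteness of a bilinear form gives nondegeneracy of its restrictions. -/
lemma restrict_nondegenerate_of_definite {B : LinearMap.BilinForm ℝ V}
    (hd : ∀ x, B x x = 0 → x = 0) (W : Submodule ℝ V) : (B.restrict W).Nondegenerate := by
  refine ⟨fun x hx => ?_, fun x hx => ?_⟩ <;>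
  · have := hx x
    simp only [LinearMap.BilinForm.restrict_apply, LinearMap.domRestrict_apply] at this
    exact Subtype.ext (hd _ this)

variable [FiniteDimensional ℝ V]

lemma isCompl_orthogonal_of_definite {B : LinearMap.BilinForm ℝ V} (hs : B.IsSymm)
    (hd : ∀ x, B x x = 0 → x = 0) (W : Submodule ℝ V) : IsCompl W (B.orthogonal W) :=
  B.isCompl_orthogonal_of_restrict_nondegenerate hs.isRefl
    (restrict_nondegenerate_of_definite hd W)

/-- A skew operator is semisimple. -/
lemma isSemisimple_of_skew {B : LinearMap.BilinForm ℝ V} (hs : B.IsSymm)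
    (hd : ∀ x, B x x = 0 → x = 0) {A : Module.End ℝ V} (hA : ∀ x y, B (A x) y = -B x (A y)) :
    A.IsSemisimple := by
  rw [Module.End.isSemisimple_iff]
  intro p hp
  refine ⟨B.orthogonal p, fun x hx y hy => ?_, isCompl_orthogonal_of_definite hs hd p⟩
  have := hx (A y) (hp hy)
  change B y (A x) = 0
  rw [← neg_eq_zero, ← hA]
  exact this

/-- The trace form of a skew operator is negative definite. -/
lemma eq_zero_of_trace_sq_of_skew {B : LinearMap.BilinForm ℝ V} (hs : B.IsSymm)
    (hd : ∀ x, x ≠ 0 → 0 < B x x) {A : Module.End ℝ V} (hA : ∀ x y, B (A x) y = -B x (A y))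
    (h0 : LinearMap.trace ℝ V (A ∘ₗ A) = 0) : A = 0 := by
  classical
  obtain ⟨v, hv⟩ := LinearMap.BilinForm.exists_orthogonal_basis (B := B) ⟨hs.eq⟩
  have hpos : ∀ i, 0 < B (v i) (v i) := fun i => hd _ (v.ne_zero i)
  have hcoord : ∀ (x : V) i, v.repr x i * B (v i) (v i) = B x (v i) := by
    intro x i
    conv_rhs => rw [← v.sum_repr x]
    simp only [map_sum, map_smul, LinearMap.sum_apply, LinearMap.smul_apply, smul_eq_mul]
    rw [Finset.sum_eq_single i]
    · intro j _ hj
      rw [show B (v j) (v i) = 0 from hv hj, mul_zero]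
    · simp
  -- In an orthogonal basis the diagonal entry of `A²` is `B (A² vᵢ) vᵢ / B vᵢ vᵢ`, and skewness
  -- moves one `A` across.
  have htr : LinearMap.trace ℝ V (A ∘ₗ A)
      = -∑ i, B (A (v i)) (A (v i)) / B (v i) (v i) := by
    rw [LinearMap.trace_eq_matrix_trace ℝ v, Matrix.trace, ← Finset.sum_neg_distrib]
    refine Finset.sum_congr rfl fun i _ => ?_
    rw [Matrix.diag_apply, LinearMap.toMatrix_apply, ← neg_div, eq_div_iff (hpos i).ne', hcoord,
      LinearMap.comp_apply, hA]
  have hnn : ∀ x, 0 ≤ B x x := fun x => by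
    by_cases hx : x = 0
    · simp [hx]
    · exact (hd x hx).le
  rw [htr, neg_eq_zero, Finset.sum_eq_zero_iff_of_nonneg
    (fun i _ => div_nonneg (hnn _) (hpos i).le)] at h0
  refine v.ext fun i => ?_
  by_contra hne
  have := h0 i (Finset.mem_univ i)
  rw [div_eq_zero_iff] at this
  exact this.elim (hd _ hne).ne' (hpos i).ne'

end LinearAlgebra

/-! ### Isolation of commuting roots. -/

section Separable

variable {R : Type*} [NormedRing R] [NormedAlgebra ℝ R] [CompleteSpace R]

/-- Commuting roots of a separable polynomial are isolated from one another. -/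
lemma eventually_eq_of_commute_of_separable {p : Polynomial ℝ} (hp : p.Separable) {b : R}
    (hb : Polynomial.aeval b p = 0) :
    ∀ᶠ a in 𝓝 b, Commute a b → Polynomial.aeval a p = 0 → a = b := by
  -- The divided difference of `p`: `p(a) - p(b) = Q(a) (a - b)` when `a` and `b` commute, and `Q(b)
  -- = p'(b)`. If `Q(b)` is a unit, so is `Q(a)` for `a` near `b`, which forces `a = b` for two
  -- roots.
  set Q : R → R := fun a => p.sum fun n r =>
    r • ∑ i ∈ Finset.range n, a ^ i * b ^ (n - 1 - i) with hQ
  have hmul : ∀ a, Commute a b → Q a * (a - b) = Polynomial.aeval a p - Polynomial.aeval b p := by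
    intro a hab
    simp only [hQ, Polynomial.aeval_eq_sum_range, Polynomial.sum_def]
    rw [← Polynomial.sum_def (f := fun n r => r • ∑ i ∈ Finset.range n, a ^ i * b ^ (n - 1 - i)),
      Polynomial.sum_over_range _ (by simp), Finset.sum_mul, ← Finset.sum_sub_distrib]
    refine Finset.sum_congr rfl fun n _ => ?_
    rw [smul_mul_assoc, hab.geom_sum₂_mul, smul_sub]
  have hQb : Q b = Polynomial.aeval b (Polynomial.derivative p) := by
    simp only [hQ, Polynomial.derivative_apply, Polynomial.sum_def, map_sum, map_mul,
      Polynomial.aeval_C, map_pow, Polynomial.aeval_X]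
    refine Finset.sum_congr rfl fun n _ => ?_
    have h1 : ∀ i ∈ Finset.range n, b ^ i * b ^ (n - 1 - i) = b ^ (n - 1) := by
      intro i hi
      rw [← pow_add, Nat.add_sub_of_le (Nat.le_sub_one_of_lt (Finset.mem_range.1 hi))]
    rw [Finset.sum_congr rfl h1, Finset.sum_const, Finset.card_range, map_natCast, mul_assoc,
      Algebra.smul_def, nsmul_eq_mul]
  have hcont : Continuous Q := by
    simp only [hQ, Polynomial.sum_def]
    fun_prop
  -- Evaluating the Bézout relation `s p + t p' = 1` at the root `b` exhibits `t(b)` as the inverse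
  -- of `p'(b)`.
  have hu : IsUnit (Q b) := by
    obtain ⟨s, t, hst⟩ := hp
    have h1 := congrArg (Polynomial.aeval b) hst
    rw [map_add, map_mul, map_mul, hb, mul_zero, zero_add, map_one] at h1
    have h2 : Polynomial.aeval b (Polynomial.derivative p) * Polynomial.aeval b t = 1 := by
      rw [← map_mul, mul_comm, map_mul, h1]
    rw [hQb]
    exact ⟨⟨_, _, h2, h1⟩, rfl⟩
  filter_upwards [hcont.continuousAt.eventually (Units.isOpen.mem_nhds hu)] with a ha hab hpa
  have h := hmul a hab
  rw [hpa, hb, sub_zero] at h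
  exact sub_eq_zero.1 ((IsUnit.mul_right_eq_zero ha).1 h)

end Separable

/-! ### Invariant inner products and definiteness of the Killing form. -/

section InvariantForm

variable {E : Type*} [NormedAddCommGroup E] [NormedSpace ℝ E]
  {G : Type*} [TopologicalSpace G] [ChartedSpace E G] [Group G]

instance finiteDimensional_lieAlg [FiniteDimensional ℝ E] : FiniteDimensional ℝ (LieAlg E G) :=
  inferInstanceAs (FiniteDimensional ℝ E)

variable [LieGroup 𝓘(ℝ, E) ∞ G]

/-- Differentiate `Ad_{g z g⁻¹} (Ad_g Y) = Ad_g (Ad_z Y)` in `z` at `1`. -/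
lemma adjointAction_lie [CompleteSpace E] (g : G) (X Y : LieAlg E G) :
    adjointAction g ⁅X, Y⁆ = ⁅adjointAction g X, adjointAction g Y⁆ := by
  obtain ⟨φ, hφ, hφ'⟩ := hasMFDerivAt_adjointAction (G := G) Y
  obtain ⟨ψ, hψ, hψ'⟩ := hasMFDerivAt_adjointAction (G := G) (adjointAction g Y)
  have h1 := hasMFDerivAt_comp_of_eq hψ (hasMFDerivAt_conj (E := E) g (p := 1) rfl) (by simp)
  have h2 := hasMFDerivAt_comp_of_eq (adjointCLM (E := E) g).hasMFDerivAt hφ rfl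
  have h3 := h2.congr_of_eventuallyEq (f₁ := fun z : G => adjointAction (g * z * g⁻¹)
    (adjointAction g Y)) (Filter.Eventually.of_forall fun z => by
      simp only [adjointAction_mul, adjointCLM_apply, adjointAction_inv_self])
  have h4 := congrArg (fun θ : E →L[ℝ] LieAlg E G => θ X)
    ((hasFDerivAt_of_hasMFDerivAt_one h3).unique (hasFDerivAt_of_hasMFDerivAt_one h1))
  have h5 : adjointCLM g (φ X) = ψ (adjointCLM g X) := h4
  rw [hφ', adjointCLM_apply, adjointCLM_apply, hψ'] at h5
  exact h5

lemma continuous_adjointAction (X : LieAlg E G) : Continuous fun η : G => adjointAction η X :=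
  (contMDiff_adjointAction X).continuous

/-- Averaging over a compact group gives an invariant inner product on the Lie algebra. -/
lemma exists_invariant_form [FiniteDimensional ℝ E] [T2Space G] [CompactSpace G] :
    ∃ B : LinearMap.BilinForm ℝ (LieAlg E G), B.IsSymm ∧ (∀ x, x ≠ 0 → 0 < B x x) ∧
      ∀ (η : G) (x y : LieAlg E G), B (adjointAction η x) (adjointAction η y) = B x y := by
  let _ : MeasurableSpace G := borel G
  have _ : BorelSpace G := ⟨rfl⟩
  have _ : IsTopologicalGroup G := topologicalGroup_of_lieGroup 𝓘(ℝ, E) ∞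
  set μ : MeasureTheory.Measure G := MeasureTheory.Measure.haar
  set b := Module.finBasis ℝ (LieAlg E G)
  set q : LieAlg E G → LieAlg E G → ℝ := fun x y => ∑ i, b.coord i x * b.coord i y with hq
  have hbc : ∀ i, Continuous (b.coord i) := fun i => (b.coord i).continuous_of_finiteDimensional
  -- The inverse makes the action of `η` on the arguments a left translation of the integration
  -- variable, which suits left-invariant Haar measure.
  have hcont : ∀ x y, Continuous fun η : G => q (adjointAction η⁻¹ x) (adjointAction η⁻¹ y) := by
    intro x y
    refine continuous_finsetSum _ fun i _ => ?_
    exact ((hbc i).comp ((continuous_adjointAction x).comp continuous_inv)).mul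
      ((hbc i).comp ((continuous_adjointAction y).comp continuous_inv))
  have hint : ∀ x y, MeasureTheory.Integrable
      (fun η : G => q (adjointAction η⁻¹ x) (adjointAction η⁻¹ y)) μ := fun x y =>
    (hcont x y).integrable_of_hasCompactSupport (HasCompactSupport.of_compactSpace _)
  have hadd : ∀ (η : G) (x y : LieAlg E G),
      adjointAction η (x + y) = adjointAction η x + adjointAction η y := fun η x y => by
    simp only [← adjointCLM_apply, map_add]
  have hsmul : ∀ (η : G) (r : ℝ) (x : LieAlg E G),
      adjointAction η (r • x) = r • adjointAction η x := fun η r x => by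
    simp only [← adjointCLM_apply, map_smul]
  have hqc : ∀ x y, q x y = q y x := fun x y => by simp only [hq, mul_comm]
  have hqa : ∀ x y z, q (x + y) z = q x z + q y z := fun x y z => by
    simp only [hq, map_add, add_mul, Finset.sum_add_distrib]
  have hqs : ∀ (r : ℝ) x z, q (r • x) z = r * q x z := fun r x z => by
    simp only [hq, map_smul, smul_eq_mul, mul_assoc, Finset.mul_sum]
  let I : LieAlg E G → LieAlg E G → ℝ := fun x y =>
    ∫ η, q (adjointAction η⁻¹ x) (adjointAction η⁻¹ y) ∂μ
  have hIc : ∀ x y, I x y = I y x := fun x y => by simp only [I, hqc]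
  have hIa : ∀ x y z, I (x + y) z = I x z + I y z := fun x y z => by
    simp only [I, hadd, hqa]
    exact MeasureTheory.integral_add (hint x z) (hint y z)
  have hIs : ∀ (r : ℝ) x z, I (r • x) z = r • I x z := fun r x z => by
    simp only [I, hsmul, hqs, smul_eq_mul]
    exact MeasureTheory.integral_const_mul _ _
  refine ⟨LinearMap.mk₂ ℝ I hIa hIs (fun x y z => by rw [hIc, hIa, hIc y, hIc z])
    (fun r x y => by rw [hIc, hIs, hIc]), ⟨fun x y => hIc x y⟩, fun x hx => ?_, fun η x y => ?_⟩
  · refine (hcont x x).integral_pos_of_hasCompactSupport_nonneg_nonzero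
      (HasCompactSupport.of_compactSpace _)
      (fun η => Finset.sum_nonneg fun i _ => mul_self_nonneg _) (x := 1) ?_
    simp only [inv_one, adjointAction_one]
    intro h0
    rw [hq, Finset.sum_eq_zero_iff_of_nonneg (fun i _ => mul_self_nonneg _)] at h0
    refine hx (b.ext_elem fun i => ?_)
    simpa using h0 i (Finset.mem_univ i)
  · change I _ _ = I x y
    simp only [I]
    rw [← MeasureTheory.integral_mul_left_eq_self
      (fun ζ : G => q (adjointAction ζ⁻¹ x) (adjointAction ζ⁻¹ y)) η⁻¹]
    simp only [← adjointAction_mul, mul_inv_rev, inv_inv]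

/-- An invariant form is infinitesimally invariant. -/
lemma lie_skew_of_invariant [FiniteDimensional ℝ E] [CompleteSpace E]
    {B : LinearMap.BilinForm ℝ (LieAlg E G)}
    (hB : ∀ (η : G) (x y : LieAlg E G), B (adjointAction η x) (adjointAction η y) = B x y)
    (X Y Z : LieAlg E G) : B ⁅X, Y⁆ Z = -B Y ⁅X, Z⁆ := by
  obtain ⟨φ, hφ, hφ'⟩ := hasMFDerivAt_adjointAction (G := G) Y
  obtain ⟨ψ, hψ, hψ'⟩ := hasMFDerivAt_adjointAction (G := G) Z
  let β : LieAlg E G →L[ℝ] LieAlg E G →L[ℝ] ℝ :=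
    LinearMap.toContinuousLinearMap (LinearMap.toContinuousLinearMap.toLinearMap ∘ₗ B)
  have hβ : ∀ x y, β x y = B x y := fun _ _ => rfl
  -- Differentiate the constant function `η ↦ B (Ad_η Y) (Ad_η Z)` at `1`.
  have h1 := (β.hasFDerivAt.comp _ (hasFDerivAt_of_hasMFDerivAt_one hφ)).clm_apply
    (hasFDerivAt_of_hasMFDerivAt_one hψ)
  have h2 := h1.congr_of_eventuallyEq (f₁ := fun _ => B Y Z)
    (Filter.Eventually.of_forall fun η => (hB _ Y Z).symm)
  have h3 := congrArg (fun θ : E →L[ℝ] ℝ => θ X) (h2.unique (hasFDerivAt_const _ _))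
  have h4 : β (adjointAction ((extChartAt 𝓘(ℝ, E) (1 : G)).symm (chartOne E G)) Y) (ψ X)
    + β (φ X) (adjointAction ((extChartAt 𝓘(ℝ, E) (1 : G)).symm (chartOne E G)) Z) = 0 := h3
  rw [chart_symm_chartOne, adjointAction_one, adjointAction_one, hβ, hβ, hφ', hψ'] at h4
  linarith

lemma ad_eq_zero_iff [CompleteSpace E] [LieAlgebra.IsSimple ℝ (LieAlg E G)] (X : LieAlg E G)
    (h : LieAlgebra.ad ℝ (LieAlg E G) X = 0) : X = 0 := by
  have h1 : X ∈ LieAlgebra.center ℝ (LieAlg E G) := by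
    refine (LieModule.mem_maxTrivSubmodule ℝ _ _ _).2 fun Y => ?_
    rw [← lie_skew, neg_eq_zero]
    exact LinearMap.congr_fun h Y
  simpa using h1

lemma invForm_isSymm [CompleteSpace E] (c : ℝ) : (invForm (E := E) (G := G) c).IsSymm :=
  ⟨fun x y => by simp [invForm, LieModule.traceForm_comm ℝ _ _ x y]⟩

lemma invForm_lie [CompleteSpace E] (c : ℝ) (X Y Z : LieAlg E G) :
    invForm c ⁅X, Y⁆ Z = -invForm c Y ⁅X, Z⁆ := by
  simp [invForm, LieModule.traceForm_apply_lie_apply' ℝ (LieAlg E G) (LieAlg E G) X Y Z]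

/-- `invForm c X X` is `c · tr (ad X)²`, and `ad X` is skew for the averaged inner product. -/
lemma invForm_definite [FiniteDimensional ℝ E] [CompleteSpace E] [T2Space G] [CompactSpace G]
    [LieAlgebra.IsSimple ℝ (LieAlg E G)] {c : ℝ} (hc : 0 < c) (X : LieAlg E G)
    (h : invForm c X X = 0) : X = 0 := by
  obtain ⟨B, hs, hd, hB⟩ := exists_invariant_form (E := E) (G := G)
  refine ad_eq_zero_iff X (eq_zero_of_trace_sq_of_skew hs hd
    (fun x y => lie_skew_of_invariant hB X x y) ?_)
  have h1 : c * LinearMap.trace ℝ _ (LieAlgebra.ad ℝ (LieAlg E G) X ∘ₗ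
    LieAlgebra.ad ℝ (LieAlg E G) X) = 0 := h
  exact (mul_eq_zero.1 h1).resolve_left hc.ne'

end InvariantForm

/-! ### Existence and properties of one-parameter subgroups. -/

section OneParameterSubgroup

variable {E : Type*} [NormedAddCommGroup E] [NormedSpace ℝ E]
  {G : Type*} [TopologicalSpace G] [ChartedSpace E G] [Group G]

lemma mulInvariantVectorField_eq_self (X : LieAlg E G) {g : G} (hg : g = 1) :
    (mulInvariantVectorField X g : E) = X := by
  subst hg
  have h : (fun x : G => (1 : G) * x) = id := by ext x; simp
  rw [mulInvariantVectorField, h]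
  exact congrArg (fun φ : E →L[ℝ] E => φ X) mfderiv_id

lemma IsOneParameterSubgroup.hasMFDerivAt_zero {X : LieAlg E G} {γ : ℝ → G}
    (h : IsOneParameterSubgroup X γ) :
    HasMFDerivAt 𝓘(ℝ, ℝ) 𝓘(ℝ, E) γ 0 ((1 : ℝ →L[ℝ] ℝ).smulRight (X : E)) := by
  have h1 := h.2 0
  have h2 : ((1 : ℝ →L[ℝ] ℝ).smulRight (mulInvariantVectorField X (γ 0) : E))
      = (1 : ℝ →L[ℝ] ℝ).smulRight (X : E) :=
    congrArg (fun v : E => (1 : ℝ →L[ℝ] ℝ).smulRight v) (mulInvariantVectorField_eq_self X h.1)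
  exact h2 ▸ h1

omit [Group G] in
lemma isMIntegralCurveOn_comp {f : G → G} {v w : (g : G) → TangentSpace 𝓘(ℝ, E) g}
    (hf : MDifferentiable 𝓘(ℝ, E) 𝓘(ℝ, E) f)
    (hvw : ∀ k, mfderiv 𝓘(ℝ, E) 𝓘(ℝ, E) f k (v k) = w (f k)) {γ : ℝ → G} {s : Set ℝ}
    (hγ : IsMIntegralCurveOn γ v s) : IsMIntegralCurveOn (fun t => f (γ t)) w s := by
  intro t ht
  have h := (hf (γ t)).hasMFDerivAt.comp_hasMFDerivWithinAt t (hγ t ht)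
  have h2 : ((mfderiv 𝓘(ℝ, E) 𝓘(ℝ, E) f (γ t) : E →L[ℝ] E).comp
      ((1 : ℝ →L[ℝ] ℝ).smulRight (v (γ t) : E)))
      = (1 : ℝ →L[ℝ] ℝ).smulRight (w (f (γ t)) : E) := by
    ext
    rw [ContinuousLinearMap.comp_apply, ContinuousLinearMap.smulRight_apply, map_smul]
    exact congrArg (fun z : E => (1 : ℝ) • z) (hvw (γ t))
  exact h2 ▸ h

variable [LieGroup 𝓘(ℝ, E) ∞ G]

lemma mfderiv_mul_left_mulInvariantVectorField (g k : G) (X : LieAlg E G) :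
    mfderiv 𝓘(ℝ, E) 𝓘(ℝ, E) (fun x : G => g * x) k (mulInvariantVectorField X k)
      = mulInvariantVectorField X (g * k) := by
  have h1 := hasMFDerivAt_comp_of_eq (mdifferentiable_mul_left (E := E) g k).hasMFDerivAt
    (mdifferentiable_mul_left (E := E) k 1).hasMFDerivAt (by simp)
  have h2 := h1.congr_of_eventuallyEq (f₁ := fun x : G => (g * k) * x)
    (Filter.Eventually.of_forall fun x => mul_assoc g k x)
  exact (congrArg (fun φ : E →L[ℝ] E => φ X) h2.mfderiv).symm

/-- Differentiate `g (k x) g⁻¹ = (g k g⁻¹) (g x g⁻¹)` in `x` at `1`. -/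
lemma mfderiv_conj_mulInvariantVectorField (g k : G) (X : LieAlg E G) :
    mfderiv 𝓘(ℝ, E) 𝓘(ℝ, E) (fun x : G => g * x * g⁻¹) k (mulInvariantVectorField X k)
      = mulInvariantVectorField (adjointAction g X) (g * k * g⁻¹) := by
  have h1 := hasMFDerivAt_comp_of_eq (mdifferentiable_conj (E := E) g k).hasMFDerivAt
    (mdifferentiable_mul_left (E := E) k 1).hasMFDerivAt (by simp)
  have h2 := hasMFDerivAt_comp_of_eq
    (mdifferentiable_mul_left (E := E) (g * k * g⁻¹) 1).hasMFDerivAt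
    (hasMFDerivAt_conj (E := E) g (p := 1) rfl) (by simp)
  have h3 := h2.congr_of_eventuallyEq (f₁ := fun x : G => g * (k * x) * g⁻¹)
    (Filter.Eventually.of_forall fun x => by simp [mul_assoc])
  exact congrArg (fun φ : E →L[ℝ] E => φ X) (h1.mfderiv.symm.trans h3.mfderiv)

lemma contMDiff_one_mulInvariantVectorField (X : LieAlg E G) :
    ContMDiff 𝓘(ℝ, E) 𝓘(ℝ, E).tangent 1
      (fun g : G => (mulInvariantVectorField X g : TangentBundle 𝓘(ℝ, E) G)) :=
  (contMDiff_mulInvariantVectorField X).of_le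
    (by rw [minSmoothness_of_isRCLikeNormedField]; exact one_le_two)

variable [T2Space G]

/-- Left translates of one local integral curve through `1` give the same existence time at every
point, so the field is complete. -/
lemma exists_isOneParameterSubgroup [CompleteSpace E] (X : LieAlg E G) :
    ∃ γ : ℝ → G, IsOneParameterSubgroup X γ := by
  have hv := contMDiff_one_mulInvariantVectorField X
  obtain ⟨γ, h0, hγ⟩ := exists_isMIntegralCurveAt_of_contMDiffAt_boundaryless
    (t₀ := 0) (hv.contMDiffAt (x := (1 : G)))
  obtain ⟨ε, hε, hγ⟩ := isMIntegralCurveAt_iff'.1 hγ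
  rw [Real.ball_eq_Ioo, zero_sub, zero_add] at hγ
  refine exists_isMIntegralCurve_of_isMIntegralCurveOn hv hε (fun g => ⟨fun t => g * γ t, ?_, ?_⟩) 1
  · simp [h0]
  · exact isMIntegralCurveOn_comp (mdifferentiable_mul_left g)
      (fun k => mfderiv_mul_left_mulInvariantVectorField g k X) hγ

/-- As functions of `t`, both sides are integral curves of the same field with the same value at
`0`. -/
lemma IsOneParameterSubgroup.mul {X : LieAlg E G} {γ : ℝ → G} (h : IsOneParameterSubgroup X γ)
    (s t : ℝ) : γ s * γ t = γ (s + t) := by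
  have h1 : IsMIntegralCurve (fun t => γ s * γ t) (mulInvariantVectorField X) :=
    isMIntegralCurve_iff_isMIntegralCurveOn.2 (isMIntegralCurveOn_comp
      (mdifferentiable_mul_left (γ s)) (fun k => mfderiv_mul_left_mulInvariantVectorField _ k X)
      (h.2.isMIntegralCurveOn Set.univ))
  have h2 := isMIntegralCurve_Ioo_eq_of_contMDiff_boundaryless (t₀ := 0)
    (contMDiff_one_mulInvariantVectorField X) h1 (h.2.comp_add s) (by simp [h.1])
  rw [congrFun h2 t, Function.comp_apply, add_comm]

lemma IsOneParameterSubgroup.conj_eq {X : LieAlg E G} {γ : ℝ → G}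
    (h : IsOneParameterSubgroup X γ) {g : G} (hg : adjointAction g X = X) (t : ℝ) :
    g * γ t * g⁻¹ = γ t := by
  have h1 : IsMIntegralCurve (fun t => g * γ t * g⁻¹) (mulInvariantVectorField X) :=
    isMIntegralCurve_iff_isMIntegralCurveOn.2 (isMIntegralCurveOn_comp
      (mdifferentiable_conj g)
      (fun k => (mfderiv_conj_mulInvariantVectorField g k X).trans (by rw [hg]))
      (h.2.isMIntegralCurveOn Set.univ))
  exact congrFun (isMIntegralCurve_Ioo_eq_of_contMDiff_boundaryless (t₀ := 0)
    (contMDiff_one_mulInvariantVectorField X) h1 h.2 (by simp [h.1])) t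

end OneParameterSubgroup

/-! ### Maximal tori and centralizers of regular elements. -/

section Torus

variable {E : Type*} [NormedAddCommGroup E] [NormedSpace ℝ E]
  {G : Type*} [TopologicalSpace G] [ChartedSpace E G] [Group G] [LieGroup 𝓘(ℝ, E) ∞ G]

/-- The Lie algebra of a torus is fixed by the torus. -/
lemma adjointAction_eq_of_mem_subgroupLie {T : Subgroup G} (hT : IsTorus T) {X : LieAlg E G}
    (hX : X ∈ subgroupLie T) {g : G} (hg : g ∈ T) : adjointAction g X = X := by
  induction hX using Submodule.span_induction with
  | mem X hX =>
    obtain ⟨γ, hγ, hγT⟩ := hX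
    have h1 := hasMFDerivAt_comp_of_eq (hasMFDerivAt_conj (E := E) g (p := 1) rfl)
      hγ.hasMFDerivAt_zero hγ.1
    have h2 := hγ.hasMFDerivAt_zero.congr_of_eventuallyEq (f₁ := fun t => g * γ t * g⁻¹)
      (Filter.Eventually.of_forall fun t => mul_inv_eq_of_eq_mul (hT.2.2 g hg _ (hγT t)))
    have h3 : adjointCLM g ((1 : ℝ) • X) = (1 : ℝ) • X :=
      congrArg (fun φ : ℝ →L[ℝ] E => φ 1) (h1.mfderiv.symm.trans h2.mfderiv)
    rwa [one_smul, adjointCLM_apply] at h3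
  | zero => simp only [← adjointCLM_apply, map_zero]
  | add X Y _ _ hX hY => simp only [← adjointCLM_apply, map_add] at *; rw [hX, hY]
  | smul r X _ hX => simp only [← adjointCLM_apply, map_smul] at *; rw [hX]

/-- Along a one-parameter subgroup of `T` the curve `Ad_{γ t} Y` is constant, while its derivative
at `0` is `⁅X, Y⁆`. -/
lemma lie_eq_zero_of_fixed [CompleteSpace E] {T : Subgroup G} {X Y : LieAlg E G}
    (hX : X ∈ subgroupLie T) (hY : ∀ g ∈ T, adjointAction g Y = Y) : ⁅X, Y⁆ = 0 := by
  induction hX using Submodule.span_induction with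
  | mem X hX =>
    obtain ⟨γ, hγ, hγT⟩ := hX
    obtain ⟨φ, hφ, hφ'⟩ := hasMFDerivAt_adjointAction (G := G) Y
    have h1 := hasMFDerivAt_comp_of_eq hφ hγ.hasMFDerivAt_zero hγ.1
    have h2 := (hasMFDerivAt_const Y (0 : ℝ) (I := 𝓘(ℝ, ℝ)) (I' := 𝓘(ℝ, LieAlg E G))).congr_of_eventuallyEq
      (f₁ := fun t => adjointAction (γ t) Y)
      (Filter.Eventually.of_forall fun t => hY _ (hγT t))
    have h3 : φ ((1 : ℝ) • (X : E)) = 0 :=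
      congrArg (fun φ : ℝ →L[ℝ] LieAlg E G => φ 1) (h1.mfderiv.symm.trans h2.mfderiv)
    rw [one_smul] at h3
    exact (hφ' X).symm.trans h3
  | zero => exact zero_lie _
  | add X Z _ _ hX hZ => rw [add_lie, hX, hZ, add_zero]
  | smul r X _ hX => rw [smul_lie, hX, smul_zero]

/-- The Lie algebra of a maximal torus contains all the vectors that the torus fixes. -/
lemma mem_subgroupLie_of_fixed [CompleteSpace E] [T2Space G] {T : Subgroup G}
    (hT : IsMaximalTorus T) {X : LieAlg E G} (hX : ∀ g ∈ T, adjointAction g X = X) :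
    X ∈ subgroupLie T := by
  have _ : IsTopologicalGroup G := topologicalGroup_of_lieGroup 𝓘(ℝ, E) ∞
  obtain ⟨γ, hγ⟩ := exists_isOneParameterSubgroup X
  have hcomm : ∀ g ∈ T, ∀ t, g * γ t = γ t * g := fun g hg t => by
    rw [← mul_inv_eq_iff_eq_mul, hγ.conj_eq (hX g hg)]
  have hinv : ∀ t, (γ t)⁻¹ = γ (-t) := fun t => by
    rw [inv_eq_iff_mul_eq_one, hγ.mul, add_neg_cancel, hγ.1]
  -- The subgroup generated by `T` and the curve of `X`. Its closure is a torus containing `T`, so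
  -- maximality puts the curve inside `T`.
  let S : Subgroup G :=
    { carrier := {y | ∃ x ∈ T, ∃ t, y = x * γ t}
      mul_mem' := by
        rintro _ _ ⟨x, hx, t, rfl⟩ ⟨y, hy, s, rfl⟩
        refine ⟨x * y, T.mul_mem hx hy, t + s, ?_⟩
        rw [← hγ.mul, mul_assoc x, ← mul_assoc (γ t), ← hcomm y hy]
        simp only [mul_assoc]
      one_mem' := ⟨1, T.one_mem, 0, by rw [hγ.1, mul_one]⟩
      inv_mem' := by
        rintro _ ⟨x, hx, t, rfl⟩
        refine ⟨x⁻¹, T.inv_mem hx, -t, ?_⟩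
        rw [mul_inv_rev, hinv, hcomm _ (T.inv_mem hx)] }
  have hTS : T ≤ S := fun x hx => ⟨x, hx, 0, by rw [hγ.1, mul_one]⟩
  have hcS : (S : Set G) ⊆ Set.centralizer (S : Set G) := by
    rintro _ ⟨x, hx, t, rfl⟩ _ ⟨y, hy, s, rfl⟩
    have hts : γ t * γ s = γ s * γ t := by rw [hγ.mul, hγ.mul, add_comm]
    have hxy := hT.1.2.2 x hx y hy
    calc y * γ s * (x * γ t) = y * (γ s * x) * γ t := by simp only [mul_assoc]
      _ = y * x * (γ s * γ t) := by rw [← hcomm x hx]; simp only [mul_assoc]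
      _ = x * (y * γ t) * γ s := by rw [← hts, ← hxy]; simp only [mul_assoc]
      _ = x * γ t * (y * γ s) := by rw [hcomm y hy]; simp only [mul_assoc]
  have hconn : IsConnected (S : Set G) := by
    have h1 : IsConnected ((fun p : G × ℝ => p.1 * γ p.2) '' ((T : Set G) ×ˢ Set.univ)) := by
      refine (hT.1.2.1.prod isConnected_univ).image _ (Continuous.continuousOn ?_)
      exact continuous_fst.mul (hγ.2.continuous.comp continuous_snd)
    convert! h1 using 1
    ext y
    constructor
    · rintro ⟨x, hx, t, rfl⟩
      exact ⟨(x, t), ⟨hx, trivial⟩, rfl⟩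
    · rintro ⟨⟨x, t⟩, ⟨hx, -⟩, rfl⟩
      exact ⟨x, hx, t, rfl⟩
  have htorus : IsTorus S.topologicalClosure := by
    refine ⟨S.isClosed_topologicalClosure, hconn.closure, fun x hx y hy => ?_⟩
    -- Centralizers are closed, so commutativity passes to the closure one factor at a time.
    have h1 : closure (S : Set G) ⊆ Set.centralizer (S : Set G) :=
      closure_minimal hcS (Set.isClosed_centralizer _)
    have h2 : closure (S : Set G) ⊆ Set.centralizer (closure (S : Set G)) :=
      closure_minimal (fun z hz w hw => (h1 hw z hz).symm) (Set.isClosed_centralizer _)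
    exact h2 hy x hx
  have hle := hT.2 htorus (hTS.trans S.le_topologicalClosure)
  exact Submodule.subset_span ⟨γ, hγ, fun t =>
    hle (S.le_topologicalClosure ⟨1, T.one_mem, t, (one_mul _).symm⟩)⟩

/-- The centralizer of a regular element of the Lie algebra of a maximal torus is this algebra. -/
lemma lie_eq_zero_iff_mem_subgroupLie [FiniteDimensional ℝ E] [CompleteSpace E] [T2Space G]
    [CompactSpace G] [LieAlgebra.IsSimple ℝ (LieAlg E G)] {T : Subgroup G}
    (hT : IsMaximalTorus T) {l : LieAlg E G} (hl : l ∈ subgroupLie T) (hreg : IsRegularElement l)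
    (X : LieAlg E G) : ⁅l, X⁆ = 0 ↔ X ∈ subgroupLie T := by
  refine ⟨fun hX => mem_subgroupLie_of_fixed hT ?_, fun hX =>
    lie_eq_zero_of_fixed hl fun g hg => adjointAction_eq_of_mem_subgroupLie hT.1 hX hg⟩
  obtain ⟨T', hT', hcent⟩ := hreg
  obtain ⟨B, hs, hd, hB⟩ := exists_invariant_form (E := E) (G := G)
  have _ : CompleteSpace (LieAlg E G) := FiniteDimensional.complete ℝ _
  have hfix : ∀ g ∈ T, ⁅l, adjointAction g X⁆ = 0 := fun g hg => by
    have h := adjointAction_lie g l X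
    rw [adjointAction_eq_of_mem_subgroupLie hT.1 hl hg, hX] at h
    rw [← h, ← adjointCLM_apply, map_zero]
  -- The centralizer of `l` is the Lie algebra of the torus `T'`, hence abelian. This is the only
  -- use of regularity.
  have habel : ∀ Y Z : LieAlg E G, ⁅l, Y⁆ = 0 → ⁅l, Z⁆ = 0 → ⁅Y, Z⁆ = 0 := fun Y Z hY hZ =>
    lie_eq_zero_of_fixed ((hcent Y).2 hY) fun g hg =>
      adjointAction_eq_of_mem_subgroupLie hT'.1 ((hcent Z).2 hZ) hg
  let A : LieAlg E G → LieAlg E G →L[ℝ] LieAlg E G := fun Y =>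
    Module.End.toContinuousLinearMap _ (LieAlgebra.ad ℝ (LieAlg E G) Y)
  have hAinj : ∀ Y Z, A Y = A Z → Y = Z := fun Y Z h => by
    have h1 := (Module.End.toContinuousLinearMap (𝕜 := ℝ) (LieAlg E G)).injective h
    rw [← sub_eq_zero, ← map_sub] at h1
    exact sub_eq_zero.1 (ad_eq_zero_iff _ h1)
  have hAcont : Continuous A := by
    let A' : LieAlg E G →ₗ[ℝ] LieAlg E G →L[ℝ] LieAlg E G :=
      { toFun := A
        map_add' := fun Y Z => by simp only [A, map_add]
        map_smul' := fun r Y => by simp only [A, map_smul, RingHom.id_apply] }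
    exact A'.continuous_of_finiteDimensional
  set p := minpoly ℝ (LieAlgebra.ad ℝ (LieAlg E G) X) with hp
  have hsep : p.Separable := PerfectField.separable_iff_squarefree.2
    (isSemisimple_of_skew hs (fun x hx => by_contra fun hne => (hd x hne).ne' hx)
      (fun x y => lie_skew_of_invariant hB X x y)).minpoly_squarefree
  -- `ad (Ad_g X)` is conjugate to `ad X` by `Ad_g`, so it satisfies the same minimal polynomial.
  have hroot : ∀ g : G, Polynomial.aeval (A (adjointAction g X)) p = 0 := fun g => by
    let e : LieAlg E G ≃ₗ[ℝ] LieAlg E G := LinearEquiv.ofLinearMap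
      (adjointCLM (E := E) g).toLinearMap (adjointCLM (E := E) g⁻¹).toLinearMap
      (LinearMap.ext fun Y => adjointAction_self_inv g Y)
      (LinearMap.ext fun Y => adjointAction_inv_self g Y)
    have h1 : LieAlgebra.ad ℝ (LieAlg E G) (adjointAction g X)
        = e.conjAlgEquiv ℝ (LieAlgebra.ad ℝ (LieAlg E G) X) := by
      ext Y
      have h2 := adjointAction_lie g X (adjointAction g⁻¹ Y)
      rw [adjointAction_self_inv] at h2
      exact h2.symm
    simp only [A]
    rw [Polynomial.aeval_algHom_apply, h1, Polynomial.aeval_algHom_apply, hp, minpoly.aeval,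
      map_zero, map_zero]
  have hconst : IsLocallyConstant fun g : T => adjointAction (g : G) X := by
    refine (IsLocallyConstant.iff_eventually_eq _).2 fun g => ?_
    have hc : ContinuousAt (fun k : T => A (adjointAction (k : G) X)) g :=
      (hAcont.comp ((continuous_adjointAction X).comp continuous_subtype_val)).continuousAt
    filter_upwards [hc.eventually (eventually_eq_of_commute_of_separable hsep (hroot g))] with k hk
    refine hAinj _ _ (hk ?_ (hroot k))
    have h1 := habel _ _ (hfix k k.2) (hfix g g.2)
    ext Y
    have h2 := leibniz_lie (adjointAction (k : G) X) (adjointAction (g : G) X) Y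
    rw [h1, zero_lie, zero_add] at h2
    exact h2
  have _ : PreconnectedSpace T := isPreconnected_iff_preconnectedSpace.1 hT.1.2.1.isPreconnected
  intro g hg
  have h := hconst.apply_eq_of_isPreconnected (PreconnectedSpace.isPreconnected_univ)
    (Set.mem_univ (⟨g, hg⟩ : T)) (Set.mem_univ 1)
  exact h.trans (adjointAction_one X)

end Torus

/-! ### Vectors representing linear functionals. -/

section Representer

variable {V : Type*} [AddCommGroup V] [Module ℝ V] [FiniteDimensional ℝ V]

lemma representer_spec {B : LinearMap.BilinForm ℝ V} (hs : B.IsSymm)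
    (hd : ∀ x, B x x = 0 → x = 0) (ℓ : V →ₗ[ℝ] ℝ) (X : V) :
    B X (representer B fun X => ℓ X) = ℓ X := by
  have hn : B.Nondegenerate :=
    ⟨fun x hx => hd x (hx x), fun x hx => hd x (hx x)⟩
  have hex : ∃ Y, ∀ X, B X Y = ℓ X := ⟨(B.toDual hn).symm ℓ, fun X => by
    rw [← hs.eq]
    exact LinearMap.BilinForm.apply_toDual_symm_apply ..⟩
  exact Classical.epsilon_spec hex X

lemma representer_zero {B : LinearMap.BilinForm ℝ V} (hs : B.IsSymm)
    (hd : ∀ x, B x x = 0 → x = 0) : representer B (fun _ => 0) = 0 :=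
  hd _ (representer_spec hs hd 0 _)

end Representer

/-! ### Partial derivatives on `G × W`. -/

section PartialDerivatives

variable {E : Type*} [NormedAddCommGroup E] [NormedSpace ℝ E]
  {G : Type*} [TopologicalSpace G] [ChartedSpace E G] [Group G] [LieGroup 𝓘(ℝ, E) ∞ G]
  {W : Type*} [NormedAddCommGroup W] [NormedSpace ℝ W] {Φ : G × W → ℝ} {g : G} {w : W}
  {D : E × W →L[ℝ] ℝ}

variable (E) in
/-- The derivative at `1` of the left translation by `g`. -/
noncomputable def leftTranslation (g : G) : LieAlg E G →L[ℝ] E :=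
  (mfderiv 𝓘(ℝ, E) 𝓘(ℝ, E) (fun x : G => g * x) 1 : E →L[ℝ] E)

variable (E) in
/-- The derivative at `1` of the right translation by `g`. -/
noncomputable def rightTranslation (g : G) : LieAlg E G →L[ℝ] E :=
  (mfderiv 𝓘(ℝ, E) 𝓘(ℝ, E) (fun x : G => x * g) 1 : E →L[ℝ] E)

lemma hasMFDerivAt_leftTranslation (g : G) :
    HasMFDerivAt 𝓘(ℝ, E) 𝓘(ℝ, E) (fun x : G => g * x) 1 (leftTranslation E g : E →L[ℝ] E) :=
  (mdifferentiable_mul_left g 1).hasMFDerivAt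

lemma hasMFDerivAt_rightTranslation (g : G) :
    HasMFDerivAt 𝓘(ℝ, E) 𝓘(ℝ, E) (fun x : G => x * g) 1 (rightTranslation E g : E →L[ℝ] E) :=
  (mdifferentiable_mul_right g 1).hasMFDerivAt

omit [LieGroup 𝓘(ℝ, E) ∞ G] in
/-- Chain rule for a function on `G × W`. -/
lemma hasMFDerivAt_comp_prodMk
    (hD : HasMFDerivAt (𝓘(ℝ, E).prod 𝓘(ℝ, W)) 𝓘(ℝ, ℝ) Φ (g, w) D)
    {a : G → G} {b : G → W} {a' : E →L[ℝ] E} {b' : E →L[ℝ] W}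
    (ha : HasMFDerivAt 𝓘(ℝ, E) 𝓘(ℝ, E) a 1 a') (hb : HasMFDerivAt 𝓘(ℝ, E) 𝓘(ℝ, W) b 1 b')
    (ha1 : a 1 = g) (hb1 : b 1 = w) :
    HasMFDerivAt 𝓘(ℝ, E) 𝓘(ℝ, ℝ) (fun x => Φ (a x, b x)) 1 (D.comp (a'.prod b')) :=
  hasMFDerivAt_comp_of_eq hD (ha.prodMk hb) (Prod.ext ha1 hb1)

lemma mfderiv_mul_left_of_prod
    (hD : HasMFDerivAt (𝓘(ℝ, E).prod 𝓘(ℝ, W)) 𝓘(ℝ, ℝ) Φ (g, w) D) (X : LieAlg E G) :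
    (mfderiv 𝓘(ℝ, E) 𝓘(ℝ, ℝ) (fun x : G => Φ (g * x, w)) 1 : LieAlg E G →L[ℝ] ℝ) X
      = D (leftTranslation E g X, 0) :=
  congrArg (fun φ : E →L[ℝ] ℝ => φ X) (hasMFDerivAt_comp_prodMk hD
    (hasMFDerivAt_leftTranslation g) (hasMFDerivAt_const w _) (mul_one g) rfl).mfderiv

lemma mfderiv_mul_right_of_prod
    (hD : HasMFDerivAt (𝓘(ℝ, E).prod 𝓘(ℝ, W)) 𝓘(ℝ, ℝ) Φ (g, w) D) (X : LieAlg E G) :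
    (mfderiv 𝓘(ℝ, E) 𝓘(ℝ, ℝ) (fun x : G => Φ (x * g, w)) 1 : LieAlg E G →L[ℝ] ℝ) X
      = D (rightTranslation E g X, 0) :=
  congrArg (fun φ : E →L[ℝ] ℝ => φ X) (hasMFDerivAt_comp_prodMk hD
    (hasMFDerivAt_rightTranslation g) (hasMFDerivAt_const w _) (one_mul g) rfl).mfderiv

omit [Group G] [LieGroup 𝓘(ℝ, E) ∞ G] in
lemma hasFDerivAt_snd_of_prod
    (hD : HasMFDerivAt (𝓘(ℝ, E).prod 𝓘(ℝ, W)) 𝓘(ℝ, ℝ) Φ (g, w) D) :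
    HasFDerivAt (fun v => Φ (g, v)) (D.comp (ContinuousLinearMap.inr ℝ E W)) w := by
  have h : HasMFDerivAt 𝓘(ℝ, W) (𝓘(ℝ, E).prod 𝓘(ℝ, W)) (fun v : W => (g, v)) w
      (ContinuousLinearMap.inr ℝ E W) :=
    (hasMFDerivAt_const g w).prodMk (hasMFDerivAt_id w)
  exact (hasMFDerivAt_comp_of_eq hD h rfl).hasFDerivAt

end PartialDerivatives

/-! ### Gradients, the dynamical `r`-matrix and the brackets. -/

section Reduction

variable {E : Type*} [NormedAddCommGroup E] [NormedSpace ℝ E] [FiniteDimensional ℝ E]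
  [CompleteSpace E] {G : Type*} [TopologicalSpace G] [ChartedSpace E G] [Group G]
  [LieGroup 𝓘(ℝ, E) ∞ G] [T2Space G] [CompactSpace G] [LieAlgebra.IsSimple ℝ (LieAlg E G)]
  {c : ℝ} (𝔱 : Submodule ℝ (LieAlg E G))

lemma nabla_spec (hc : 0 < c) (f : G → ℝ) (g : G) (X : LieAlg E G) :
    invForm c X (nabla c f g)
      = (mfderiv 𝓘(ℝ, E) 𝓘(ℝ, ℝ) (fun x : G => f (x * g)) 1 : LieAlg E G →L[ℝ] ℝ) X :=
  representer_spec (invForm_isSymm c) (invForm_definite hc)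
    (mfderiv 𝓘(ℝ, E) 𝓘(ℝ, ℝ) (fun x : G => f (x * g)) 1 : LieAlg E G →L[ℝ] ℝ).toLinearMap X

lemma nabla'_spec (hc : 0 < c) (f : G → ℝ) (g : G) (X : LieAlg E G) :
    invForm c X (nabla' c f g)
      = (mfderiv 𝓘(ℝ, E) 𝓘(ℝ, ℝ) (fun x : G => f (g * x)) 1 : LieAlg E G →L[ℝ] ℝ) X :=
  representer_spec (invForm_isSymm c) (invForm_definite hc)
    (mfderiv 𝓘(ℝ, E) 𝓘(ℝ, ℝ) (fun x : G => f (g * x)) 1 : LieAlg E G →L[ℝ] ℝ).toLinearMap X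

lemma invForm_nabla_of_prod {W : Type*} [NormedAddCommGroup W] [NormedSpace ℝ W] (hc : 0 < c)
    {Φ : G × W → ℝ} {g : G} {w : W} {D : E × W →L[ℝ] ℝ}
    (hD : HasMFDerivAt (𝓘(ℝ, E).prod 𝓘(ℝ, W)) 𝓘(ℝ, ℝ) Φ (g, w) D) (X : LieAlg E G) :
    invForm c X (nabla c (fun x => Φ (x, w)) g) = D (rightTranslation E g X, 0) :=
  (nabla_spec hc _ g X).trans (mfderiv_mul_right_of_prod hD X)

lemma invForm_nabla'_of_prod {W : Type*} [NormedAddCommGroup W] [NormedSpace ℝ W] (hc : 0 < c)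
    {Φ : G × W → ℝ} {g : G} {w : W} {D : E × W →L[ℝ] ℝ}
    (hD : HasMFDerivAt (𝓘(ℝ, E).prod 𝓘(ℝ, W)) 𝓘(ℝ, ℝ) Φ (g, w) D) (X : LieAlg E G) :
    invForm c X (nabla' c (fun x => Φ (x, w)) g) = D (leftTranslation E g X, 0) :=
  (nabla'_spec hc _ g X).trans (mfderiv_mul_left_of_prod hD X)

lemma lieGrad_spec (hc : 0 < c) (φ : LieAlg E G → ℝ) (J X : LieAlg E G) :
    invForm c X (lieGrad c φ J) = fderiv ℝ φ J X :=
  representer_spec (invForm_isSymm c) (invForm_definite hc) (fderiv ℝ φ J).toLinearMap X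

lemma lieGrad_const (hc : 0 < c) (r : ℝ) (J : LieAlg E G) : lieGrad c (fun _ => r) J = 0 := by
  simpa [lieGrad] using representer_zero (invForm_isSymm c) (invForm_definite (G := G) hc)

omit [FiniteDimensional ℝ E] [T2Space G] [CompactSpace G] [LieAlgebra.IsSimple ℝ (LieAlg E G)] in
lemma invForm_restrict_isSymm : ((invForm c).restrict 𝔱).IsSymm :=
  ⟨fun x y => (invForm_isSymm (E := E) (G := G) c).eq x y⟩

lemma invForm_restrict_definite (hc : 0 < c) (x : 𝔱) (h : (invForm c).restrict 𝔱 x x = 0) :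
    x = 0 :=
  Subtype.ext (invForm_definite hc _ h)

lemma torusGrad_spec (hc : 0 < c) (F : G × 𝔱 → ℝ) (g : G) (l X : 𝔱) :
    invForm c (X : LieAlg E G) (torusGrad 𝔱 c F g l : LieAlg E G)
      = fderiv ℝ (fun m : 𝔱 => F (g, m)) l X :=
  representer_spec (invForm_restrict_isSymm 𝔱) (invForm_restrict_definite 𝔱 hc)
    (fderiv ℝ (fun m : 𝔱 => F (g, m)) l).toLinearMap X

lemma torusGrad_restrict_fst (hc : 0 < c) (h : G → ℝ) (g : G) (l : 𝔱) :
    torusGrad 𝔱 c (restrict 𝔱 fun p => h p.1) g l = 0 := by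
  simpa [torusGrad, restrict] using representer_zero (invForm_restrict_isSymm (c := c) 𝔱)
    (invForm_restrict_definite 𝔱 hc)

lemma sub_zeroPart_mem_perp (hc : 0 < c) (X : LieAlg E G) :
    X - (zeroPart 𝔱 c X : LieAlg E G) ∈ perp 𝔱 c := by
  have h := isCompl_orthogonal_of_definite (invForm_isSymm c) (invForm_definite (G := G) hc) 𝔱
  obtain ⟨y, hy, z, hz, rfl⟩ := Submodule.mem_sup.1
    (h.sup_eq_top ▸ Submodule.mem_top : X ∈ 𝔱 ⊔ (invForm c).orthogonal 𝔱)
  have hex : ∃ Y : 𝔱, y + z - (Y : LieAlg E G) ∈ perp 𝔱 c :=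
    ⟨⟨y, hy⟩, by rw [add_sub_cancel_left]; exact hz⟩
  exact Classical.epsilon_spec hex

lemma invForm_zeroPart (hc : 0 < c) (Y : 𝔱) (X : LieAlg E G) :
    invForm c (Y : LieAlg E G) (zeroPart 𝔱 c X : LieAlg E G) = invForm c (Y : LieAlg E G) X := by
  have h : invForm c (Y : LieAlg E G) (X - (zeroPart 𝔱 c X : LieAlg E G)) = 0 :=
    sub_zeroPart_mem_perp 𝔱 hc X Y Y.2
  rw [map_sub, sub_eq_zero] at h
  exact h.symm

/-- On the orthogonal complement of its centralizer, `ad l` is invertible. -/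
lemma lie_rMatrix (hc : 0 < c) {l : 𝔱} (hl : ∀ X : LieAlg E G, ⁅(l : LieAlg E G), X⁆ = 0 ↔ X ∈ 𝔱)
    (X : LieAlg E G) :
    ⁅(l : LieAlg E G), rMatrix 𝔱 c l X⁆ = X - (zeroPart 𝔱 c X : LieAlg E G) := by
  -- `ad l` is skew and kills `𝔱`, so it preserves `𝔱^⊥`. Its kernel there is `𝔱 ∩ 𝔱^⊥ = 0`, and
  -- finite dimension gives surjectivity.
  have hmaps : ∀ Y ∈ perp 𝔱 c, LieAlgebra.ad ℝ (LieAlg E G) (l : LieAlg E G) Y ∈ perp 𝔱 c := by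
    intro Y hY n hn
    change invForm c n ⁅(l : LieAlg E G), Y⁆ = 0
    rw [← neg_eq_zero, ← invForm_lie, (hl n).2 hn, map_zero, LinearMap.zero_apply]
  have hinj : Function.Injective
      ((LieAlgebra.ad ℝ (LieAlg E G) (l : LieAlg E G)).restrict hmaps) := by
    rw [← LinearMap.ker_eq_bot, LinearMap.ker_eq_bot']
    intro Y hY
    have h1 : (Y : LieAlg E G) ∈ 𝔱 := (hl Y).1 (congrArg Subtype.val hY)
    exact Subtype.ext (invForm_definite hc _ (Y.2 Y h1))
  obtain ⟨Z, hZ⟩ := LinearMap.surjective_of_injective hinj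
    ⟨X - (zeroPart 𝔱 c X : LieAlg E G), sub_zeroPart_mem_perp 𝔱 hc X⟩
  exact Function.invFunOn_eq (f := fun Y : LieAlg E G => ⁅(l : LieAlg E G), Y⁆)
    ⟨Z, Z.2, congrArg Subtype.val hZ⟩

/-- The simplified bracket, in terms of the derivative of `F`. -/
lemma simplifiedBracket_eq (hc : 0 < c) {F : G × 𝔱 → ℝ} {g : G} {l : 𝔱} {D : E × 𝔱 →L[ℝ] ℝ}
    (hD : HasMFDerivAt (𝓘(ℝ, E).prod 𝓘(ℝ, 𝔱)) 𝓘(ℝ, ℝ) F (g, l) D) (h : G → ℝ) :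
    simplifiedBracket 𝔱 c F h g l = D (evolutionField 𝔱 c h (g, l)) := by
  obtain ⟨R, hR⟩ : ∃ R, R = rMatrix 𝔱 c l (nabla c h g) := ⟨_, rfl⟩
  have hs := invForm_isSymm (E := E) (G := G) c
  have h1 : evolutionField 𝔱 c h (g, l) = ((leftTranslation E g R - rightTranslation E g R : E),
      -zeroPart 𝔱 c (nabla c h g)) := by rw [hR]; rfl
  have h2 : ((leftTranslation E g R - rightTranslation E g R : E), -zeroPart 𝔱 c (nabla c h g))
      = ((leftTranslation E g R, 0) : E × 𝔱) - (rightTranslation E g R, 0)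
        - (0, zeroPart 𝔱 c (nabla c h g)) := by simp
  rw [simplifiedBracket, ← hR, h1, h2, map_sub D, map_sub D, ← invForm_nabla_of_prod hc hD,
    ← invForm_nabla'_of_prod hc hD, hs.eq _ R, map_sub,
    ← invForm_zeroPart 𝔱 hc, hs.eq (torusGrad 𝔱 c F g l : LieAlg E G), torusGrad_spec 𝔱 hc,
    (hasFDerivAt_snd_of_prod hD).fderiv]
  simp
  ring

-- Conjugating `x g` by `g` gives `g x`, so the functions being differentiated coincide.
omit [FiniteDimensional ℝ E] [T2Space G] [CompactSpace G] [LieAlgebra.IsSimple ℝ (LieAlg E G)] in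
lemma nabla'_eq_nabla {h : G → ℝ} (hinv : ∀ η g : G, h (η * g * η⁻¹) = h g) (g : G) :
    nabla' c h g = nabla (E := E) c h g := by
  have : (fun x => h (g * x)) = fun x => h (x * g) := by
    ext x
    rw [← hinv g (x * g), ← mul_assoc, mul_inv_cancel_right]
  exact congrArg (fun f : G → ℝ => representer (invForm (E := E) (G := G) c) fun X =>
    mfderiv 𝓘(ℝ, E) 𝓘(ℝ, ℝ) f 1 X) this

lemma reducedBracket_eq_simplifiedBracket (hc : 0 < c) {h : G → ℝ}
    (hinv : ∀ η g : G, h (η * g * η⁻¹) = h g) (F : G × 𝔱 → ℝ) (g : G) (l : 𝔱) :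
    reducedBracket 𝔱 c F (restrict 𝔱 fun p => h p.1) g l = simplifiedBracket 𝔱 c F h g l := by
  have h1 : (fun x => restrict 𝔱 (fun p => h p.1) (x, l)) = h := rfl
  rw [reducedBracket, simplifiedBracket, torusGrad_restrict_fst 𝔱 hc, h1, nabla'_eq_nabla hinv,
    (invForm_isSymm c).eq (nabla c h g), map_sub, LinearMap.sub_apply]
  simp
  ring

/-- The infinitesimal form of the invariance of a function. -/
lemma nabla'_sub_nabla_of_invariant (hc : 0 < c) {𝓕 : G × LieAlg E G → ℝ}
    (h𝓕 : IsSmoothInvariant 𝓕) {g : G} {J : LieAlg E G} (hJ : IsRegularElement J)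
    (X : LieAlg E G) :
    invForm c X (nabla' c (fun x => 𝓕 (x, J)) g - nabla c (fun x => 𝓕 (x, J)) g)
      = invForm c ⁅X, J⁆ (lieGrad c (fun K => 𝓕 (g, K)) J) := by
  have hd := (h𝓕.1 g J hJ).mdifferentiableAt (by simp)
  obtain ⟨D, hD⟩ : ∃ D : E × LieAlg E G →L[ℝ] ℝ,
    HasMFDerivAt (𝓘(ℝ, E).prod 𝓘(ℝ, LieAlg E G)) 𝓘(ℝ, ℝ) 𝓕 (g, J) D := ⟨_, hd.hasMFDerivAt⟩
  obtain ⟨φ, hφ, hφ'⟩ : ∃ φ : LieAlg E G →L[ℝ] LieAlg E G, HasMFDerivAt 𝓘(ℝ, E)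
    𝓘(ℝ, LieAlg E G) (fun η : G => adjointAction η J) 1 (φ : E →L[ℝ] LieAlg E G) ∧
      ∀ X, φ X = ⁅X, J⁆ := hasMFDerivAt_adjointAction (G := G) J
  have h1 := hasMFDerivAt_comp_prodMk hD (hasMFDerivAt_rightTranslation g) hφ (one_mul g)
    (adjointAction_one J)
  have h2 := hasMFDerivAt_comp_prodMk hD (hasMFDerivAt_leftTranslation g)
    (hasMFDerivAt_const J _) (mul_one g) rfl
  -- Acting by `η` on `(g η, J)` gives `(η g, Ad_η J)`. Differentiating the equality of values at `η
  -- = 1` compares left and right translation.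
  have h3 := h1.congr_of_eventuallyEq (f₁ := fun η : G => 𝓕 (g * η, J))
    (Filter.Eventually.of_forall fun η => by
      simp only
      rw [← h𝓕.2 η (g * η) J hJ, ← mul_assoc, mul_inv_cancel_right])
  have h4 : D (rightTranslation E g X, φ X) = D (leftTranslation E g X, 0) :=
    congrArg (fun φ : E →L[ℝ] ℝ => φ X) (h3.mfderiv.symm.trans h2.mfderiv)
  have h5 : ((rightTranslation E g X, φ X) : E × LieAlg E G)
    = (rightTranslation E g X, 0) + (0, φ X) := by simp
  rw [h5, map_add, ← invForm_nabla_of_prod hc hD, ← invForm_nabla'_of_prod hc hD, hφ'] at h4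
  rw [map_sub, ← h4, lieGrad_spec hc, (hasFDerivAt_snd_of_prod hD).fderiv]
  simp

lemma torusGrad_restrict (hc : 0 < c) {𝓕 : G × LieAlg E G → ℝ} (h𝓕 : IsSmoothInvariant 𝓕)
    (g : G) {l : 𝔱} (hl : IsRegularElement (l : LieAlg E G)) (X : 𝔱) :
    invForm c (X : LieAlg E G) (torusGrad 𝔱 c (restrict 𝔱 𝓕) g l : LieAlg E G)
      = invForm c (X : LieAlg E G) (lieGrad c (fun K => 𝓕 (g, K)) l) := by
  have hd := (h𝓕.1 g l hl).mdifferentiableAt (by simp)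
  have h1 := hasFDerivAt_snd_of_prod hd.hasMFDerivAt
  have h2 := h1.comp l 𝔱.subtypeL.hasFDerivAt
  rw [torusGrad_spec 𝔱 hc, lieGrad_spec hc, h1.fderiv]
  exact congrArg (fun φ : 𝔱 →L[ℝ] ℝ => φ X) h2.fderiv

/-- Since `d₂𝓗 = 0`, the left side is `-⟨∇h, d₂𝓕⟩`. On the right the torus gradient accounts for
`-⟨(∇h)₀, d₂𝓕⟩`, and the `r`-matrix term for `⟨[r(l)∇h, l], d₂𝓕⟩ = -⟨∇h - (∇h)₀, d₂𝓕⟩`. -/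
lemma poissonBracket_eq_simplifiedBracket (hc : 0 < c) (h : G → ℝ)
    {𝓕 : G × LieAlg E G → ℝ} (h𝓕 : IsSmoothInvariant 𝓕) (g : G) {l : 𝔱}
    (hreg : IsRegularElement (l : LieAlg E G))
    (hl : ∀ X : LieAlg E G, ⁅(l : LieAlg E G), X⁆ = 0 ↔ X ∈ 𝔱) :
    poissonBracket c 𝓕 (fun p => h p.1) g (l : LieAlg E G)
      = simplifiedBracket 𝔱 c (restrict 𝔱 𝓕) h g l := by
  have hs := invForm_isSymm (E := E) (G := G) c
  have h1 : (fun x => restrict 𝔱 𝓕 (x, l)) = fun x => 𝓕 (x, (l : LieAlg E G)) := rfl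
  have h2 : lieGrad c (fun K => h ((g, K) : G × LieAlg E G).1) (l : LieAlg E G) = 0 :=
    lieGrad_const hc (h g) _
  rw [poissonBracket, simplifiedBracket, h1, h2, lie_zero, map_zero, map_zero,
    hs.eq _ (rMatrix 𝔱 c l (nabla c h g)), nabla'_sub_nabla_of_invariant hc h𝓕 hreg, ← lie_skew,
    lie_rMatrix 𝔱 hc hl, ← invForm_zeroPart 𝔱 hc,
    hs.eq (torusGrad 𝔱 c (restrict 𝔱 𝓕) g l : LieAlg E G), torusGrad_restrict 𝔱 hc h𝓕 g hreg,
    map_neg, map_sub, LinearMap.neg_apply, LinearMap.sub_apply]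
  ring

end Reduction

end CotangentReduction

theorem proposition2p6
    {E : Type*} [NormedAddCommGroup E] [NormedSpace ℝ E] [FiniteDimensional ℝ E] [CompleteSpace E]
    {G : Type*} [TopologicalSpace G] [ChartedSpace E G] [Group G] [LieGroup 𝓘(ℝ, E) ∞ G]
    [T2Space G] [CompactSpace G] [SimplyConnectedSpace G]
    [LieAlgebra.IsSimple ℝ (LieAlg E G)]
    (G₀ : Subgroup G) (hG₀ : IsMaximalTorus G₀)
    (𝔱 : Submodule ℝ (LieAlg E G)) (h𝔱 : 𝔱 = subgroupLie G₀)
    (c : ℝ) (hc : 0 < c)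
    (h : G → ℝ) (hsmooth : ContMDiff 𝓘(ℝ, E) 𝓘(ℝ, ℝ) ∞ h)
    (hinv : ∀ η g : G, h (η * g * η⁻¹) = h g) :
    -- the reduced bracket formula simplifies
    (∀ F : G × 𝔱 → ℝ, IsSmoothOnRegular 𝔱 F →
      ∀ (g : G) (l : 𝔱), IsRegularElement (l : LieAlg E G) →
        reducedBracket 𝔱 c F (restrict 𝔱 fun p => h p.1) g l = simplifiedBracket 𝔱 c F h g l) ∧
    -- it gives the reduced Poisson bracket
    (∀ 𝓕 : G × LieAlg E G → ℝ, IsSmoothInvariant 𝓕 →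
      ∀ (g : G) (l : 𝔱), IsRegularElement (l : LieAlg E G) →
        poissonBracket c 𝓕 (fun p => h p.1) g (l : LieAlg E G)
          = simplifiedBracket 𝔱 c (restrict 𝔱 𝓕) h g l) ∧
    -- it is the derivative along the evolution vector field
    (∀ F : G × 𝔱 → ℝ, IsSmoothOnRegular 𝔱 F →
      ∀ p : G × 𝔱, IsRegularElement (p.2 : LieAlg E G) →
        mfderiv (𝓘(ℝ, E).prod 𝓘(ℝ, 𝔱)) 𝓘(ℝ, ℝ) F p (evolutionField 𝔱 c h p)
          = simplifiedBracket 𝔱 c F h p.1 p.2) ∧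
    -- and hence the time derivative along the solutions of the evolution equation
    (∀ (γ : ℝ → G × 𝔱) (s : Set ℝ),
      (∀ t ∈ s, IsRegularElement ((γ t).2 : LieAlg E G)) →
      IsMIntegralCurveOn (I := 𝓘(ℝ, E).prod 𝓘(ℝ, 𝔱)) γ (evolutionField 𝔱 c h) s →
      ∀ F : G × 𝔱 → ℝ, IsSmoothOnRegular 𝔱 F → ∀ t ∈ s,
        HasDerivWithinAt (fun u => F (γ u)) (simplifiedBracket 𝔱 c F h (γ t).1 (γ t).2) s t) := by

  -- `IsRegularElement` mentions an unspecified maximal torus; this identifies its Lie algebra with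
  -- that of `G₀`.
  have hreg : ∀ l : 𝔱, IsRegularElement (l : LieAlg E G) →
      ∀ X : LieAlg E G, ⁅(l : LieAlg E G), X⁆ = 0 ↔ X ∈ 𝔱 := by
    subst h𝔱
    exact fun l hl X => lie_eq_zero_iff_mem_subgroupLie hG₀ l.2 hl X
  refine ⟨fun F _ g l _ => reducedBracket_eq_simplifiedBracket 𝔱 hc hinv F g l,
    fun 𝓕 h𝓕 g l hl => poissonBracket_eq_simplifiedBracket 𝔱 hc h h𝓕 g hl (hreg l hl),
    fun F hF p hp => ?_, fun γ s hγ hint F hF t ht => ?_⟩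
  · have hd := (hF p.1 p.2 hp).mdifferentiableAt (by simp)
    exact (simplifiedBracket_eq 𝔱 hc hd.hasMFDerivAt h).symm
  · have hd := (hF (γ t).1 (γ t).2 (hγ t ht)).mdifferentiableAt (by simp)
    obtain ⟨D, hD⟩ : ∃ D : E × 𝔱 →L[ℝ] ℝ, HasMFDerivAt (𝓘(ℝ, E).prod 𝓘(ℝ, 𝔱)) 𝓘(ℝ, ℝ) F
      ((γ t).1, (γ t).2) D := ⟨_, hd.hasMFDerivAt⟩
    obtain ⟨v, hv⟩ : ∃ v : E × 𝔱, v = evolutionField 𝔱 c h ((γ t).1, (γ t).2) := ⟨_, rfl⟩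
    have h1 : HasMFDerivWithinAt 𝓘(ℝ, ℝ) (𝓘(ℝ, E).prod 𝓘(ℝ, 𝔱)) γ s t
      ((1 : ℝ →L[ℝ] ℝ).smulRight v) := hv ▸ hint t ht
    have h2 : HasFDerivWithinAt (fun u => F (γ u)) (D.comp ((1 : ℝ →L[ℝ] ℝ).smulRight v)) s t :=
      (HasMFDerivAt.comp_hasMFDerivWithinAt t hD h1).hasFDerivWithinAt
    rw [simplifiedBracket_eq 𝔱 hc hD h]
    refine h2.hasDerivWithinAt.congr_deriv ?_
    have h3 : D ((1 : ℝ) • v) = D v := by rw [one_smul]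
    exact h3.trans (congrArg D hv)
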